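/- A total coloring of a graph assigns colors to its vertices and edges so that any two adjacent or incident elements receive distinct colors; the least number of colors in a total coloring of $G$ is the total chromatic number $\chi''(G)$. A finite graph is Halin if it is obtained from a plane embedding of a tree with at least three leaves by adding a cycle through all the leaves, with no crossing edges, that is, the cycle joins the leaves in their cyclic order around the plane tree. Let $K_4$ be the complete graph on four vertices, and let $H_4$, $H_5$, $H_8$ be the following cubic graphs. - $H_4$ has vertices $0,\dots,9$. Its edges are those of the cycle $0\,1\,2\,3\,4\,5$, those of the path $6\,7\,8\,9$, and $\{0,6\},\{1,6\},\{2,7\},\{3,8\},\{4,9\},\{5,9\}$. - $H_5$ has vertices $0,\dots,11$. Its edges are those of the cycle $0\,1\,2\,3\,4\,5\,6$, those of the path $7\,8\,9\,10\,11$, and $\{0,7\},\{1,7\},\{2,8\},\{3,9\},\{4,10\},\{5,11\},\{6,11\}$. - $H_8$ has vertices $0,\dots,17$. Its edges are those of the cycle $0\,1\,2\,3\,4\,5\,6\,7\,8\,9$, those of the path $10\,11\,12\,13\,15\,16\,17$, the edge $\{13,14\}$, and $\{0,10\},\{1,10\},\{2,11\},\{3,12\},\{4,14\},\{5,14\},\{6,15\},\{7,16\},\{8,17\},\{9,17\}$.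 **Theorem.** Every cubic Halin graph $H$ that is not isomorphic to $K_4$, $H_4$, $H_5$ or $H_8$ satisfies $\chi''(H)=4$. Each of $K_4$, $H_4$, $H_5$, $H_8$ is a cubic Halin graph with total chromatic number $5$. -/

import Mathlib

namespace HalinGraph

variable {V : Type*}

/-- The total graph of `G`: its vertices are the vertices and the edges of `G`, and two of them are
joined when they are adjacent vertices, distinct edges with a common end, or an edge and one of its
ends. A proper colouring of it is a total colouring of `G`. -/
def totalGraph (G : SimpleGraph V) : SimpleGraph (V ⊕ G.edgeSet) where
  Adj
    | Sum.inl u, Sum.inl v => G.Adj u v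
    | Sum.inl u, Sum.inr e => u ∈ (e : Sym2 V)
    | Sum.inr e, Sum.inl u => u ∈ (e : Sym2 V)
    | Sum.inr e, Sum.inr f => e ≠ f ∧ ∃ u : V, u ∈ (e : Sym2 V) ∧ u ∈ (f : Sym2 V)
  symm := ⟨by
    rintro (u | e) (v | f) h
    · exact G.adj_symm h
    · exact h
    · exact h
    · exact ⟨h.1.symm, h.2.imp fun _ hu => hu.symm⟩⟩
  loopless := ⟨by
    rintro (u | e) h
    · exact G.irrefl h
    · exact h.1 rfl⟩

/-- The total chromatic number: the least number of colours in a total colouring. -/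
noncomputable def totalChromaticNumber (G : SimpleGraph V) : ℕ∞ :=
  (totalGraph G).chromaticNumber

/-- A leaf is a vertex with exactly one neighbour. -/
def IsLeaf (T : SimpleGraph V) (v : V) : Prop :=
  ∃! w, T.Adj v w

/-- A rotation system on `T`: for every vertex `v`, a cyclic order of the darts (oriented edges)
that leave `v`, read as their anticlockwise order around `v` in a drawing on an oriented surface.
For a tree every rotation system is that of a drawing in the plane, and it determines the drawing
up to an orientation-preserving homeomorphism of the sphere, so that a rotation system on a
finite tree is a plane embedding of it. -/
structure RotationSystem (T : SimpleGraph V) where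
  /-- The next dart around the same starting point. -/
  rot : Equiv.Perm T.Dart
  fst_rot : ∀ d : T.Dart, (rot d).fst = d.fst
  sameCycle : ∀ d d' : T.Dart, d.fst = d'.fst → rot.SameCycle d d'

namespace RotationSystem

variable {T : SimpleGraph V}

/-- One step along the boundary of a face: go along the dart `d`, then leave its end point by the
dart that comes after the reversal of `d` around that point. A plane tree has one face, and
repeated steps run around the whole tree. -/
def faceStep (R : RotationSystem T) (d : T.Dart) : T.Dart :=
  R.rot d.symm

/-- `R.NextLeaf l m`: walking around the plane tree from the leaf `l`, the first leaf that is
reached is `m`. -/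
def NextLeaf (R : RotationSystem T) (l m : V) : Prop :=
  IsLeaf T l ∧ IsLeaf T m ∧ ∃ (d : T.Dart) (k : ℕ), d.fst = l ∧
    (R.faceStep^[k] d).snd = m ∧ ∀ i < k, ¬ IsLeaf T (R.faceStep^[i] d).snd

/-- The graph that joins leaves that are consecutive around the plane tree. If the tree is finite
with at least three leaves, this is the cycle through all the leaves that can be added to the plane
tree without crossings. -/
def leafCycle (R : RotationSystem T) : SimpleGraph V :=
  SimpleGraph.fromRel R.NextLeaf

end RotationSystem

/-- A finite graph is Halin if it is the union of a plane tree with at least three leaves and the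
cycle that passes through its leaves in their order around the plane tree. Tree vertices of degree
two are not excluded here; in a cubic graph they cannot occur, because they would keep
degree two. -/
def IsHalin [Finite V] (G : SimpleGraph V) : Prop :=
  ∃ (T : SimpleGraph V) (R : RotationSystem T),
    T.IsTree ∧ 3 ≤ {v | IsLeaf T v}.ncard ∧ G = T ⊔ R.leafCycle

/-- The edges of the cycle `0, 1, …, 5`, the edges from its vertices into the tree, and the path
`6, 7, 8, 9` of the remaining tree vertices. -/
def edgesH4 : Finset (Sym2 (Fin 10)) :=
  {s(0, 1), s(1, 2), s(2, 3), s(3, 4), s(4, 5), s(5, 0),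
   s(0, 6), s(1, 6), s(2, 7), s(3, 8), s(4, 9), s(5, 9),
   s(6, 7), s(7, 8), s(8, 9)}

/-- The edges of the cycle `0, 1, …, 6`, the edges from its vertices into the tree, and the path
`7, 8, 9, 10, 11` of the remaining tree vertices. -/
def edgesH5 : Finset (Sym2 (Fin 12)) :=
  {s(0, 1), s(1, 2), s(2, 3), s(3, 4), s(4, 5), s(5, 6), s(6, 0),
   s(0, 7), s(1, 7), s(2, 8), s(3, 9), s(4, 10), s(5, 11), s(6, 11),
   s(7, 8), s(8, 9), s(9, 10), s(10, 11)}

/-- The edges of the cycle `0, 1, …, 9`, the edges from its vertices into the tree, and the edges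
between the remaining tree vertices: the path `10, 11, 12, 13, 15, 16, 17` and the edge from its
middle vertex `13` to `14`. -/
def edgesH8 : Finset (Sym2 (Fin 18)) :=
  {s(0, 1), s(1, 2), s(2, 3), s(3, 4), s(4, 5), s(5, 6), s(6, 7), s(7, 8), s(8, 9), s(9, 0),
   s(0, 10), s(1, 10), s(2, 11), s(3, 12), s(4, 14), s(5, 14), s(6, 15), s(7, 16), s(8, 17),
   s(9, 17),
   s(10, 11), s(11, 12), s(12, 13), s(13, 14), s(13, 15), s(15, 16), s(16, 17)}

/-- The complete graph on four vertices. -/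
abbrev K4 : SimpleGraph (Fin 4) := ⊤

/-- The cubic Halin graph on 10 vertices with total chromatic number five. -/
abbrev H4 : SimpleGraph (Fin 10) := SimpleGraph.fromEdgeSet (edgesH4 : Set (Sym2 (Fin 10)))

/-- The cubic Halin graph on 12 vertices with total chromatic number five. -/
abbrev H5 : SimpleGraph (Fin 12) := SimpleGraph.fromEdgeSet (edgesH5 : Set (Sym2 (Fin 12)))

/-- The cubic Halin graph on 18 vertices with total chromatic number five. -/
abbrev H8 : SimpleGraph (Fin 18) := SimpleGraph.fromEdgeSet (edgesH8 : Set (Sym2 (Fin 18)))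

end HalinGraph

/-! In a cubic Halin graph every inner vertex of the plane tree has degree three. Choosing one leaf
as the root leaf and walking away from it, the rest of the plane tree becomes a plane binary tree
`t`, and the graph is `halin t` (`exists_iso_halin`). Different root leaves and orientations can
give different trees for the same graph, so an exceptional graph occurs for several `t`.

Without the root leaf, the graph is a piece with only three dangling edges: at the root of `t`, at
its first leaf and at its last leaf. Whether a 4-colouring extends to the rest depends only on the
colours of these edges and of their ends. A piece is therefore described by the set of triples of
ports that it realizes (`Real`). The set of a node is determined by the sets of its two subtrees,
and the graph is totally 4-colourable if and only if some realized triple fits to the root leaf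
(`halin_colorable_iff`).

The four colours can be permuted, so the root port may be fixed as `(c0, c1)`. What remains is a set
of pairs of ports with 12 possible values each, stored as the bits of a natural number (`treeMask`).
The map `nodeMask` that glues two such sets is monotone. This reduces infinitely many trees to a
finite check: `smallTrees` is a finite list of trees with their exact sets, and `lowerMasks` is a
finite list of sets which need not belong to trees. For any two members of the two lists together,
the glued set either is that of a listed tree, with this very tree as the node, or contains a member
of `lowerMasks`. By induction every tree is listed or has a set that contains a lower one
(`mem_or_exists_maskLe`). All lower sets fit to a root leaf, and so do the sets of the listed trees,
except for the single leaf and the trees that belong to `K4`, `H4`, `H5` and `H8`.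

For the four exceptional graphs the set of one tree each shows that four colours do not suffice, and
explicit colourings with five colours are given. Three colours never suffice, because a vertex and
its three edges need four. -/

namespace HalinGraph

/-! ### The Halin graph of a plane binary tree -/

/-- Plane binary trees. -/
inductive BinTree
  | leaf
  | node (l r : BinTree)

namespace BinTree

/-- The vertices of a plane binary tree. -/
def Pos : BinTree → Type
  | leaf => Unit
  | node l r => Option (Pos l ⊕ Pos r)

instance decidableEqPos : (t : BinTree) → DecidableEq (Pos t)
  | leaf => inferInstanceAs (DecidableEq Unit)
  | node l r =>
    letI := decidableEqPos l
    letI := decidableEqPos r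
    inferInstanceAs (DecidableEq (Option (Pos l ⊕ Pos r)))

instance fintypePos : (t : BinTree) → Fintype (Pos t)
  | leaf => inferInstanceAs (Fintype Unit)
  | node l r =>
    letI := fintypePos l
    letI := fintypePos r
    inferInstanceAs (Fintype (Option (Pos l ⊕ Pos r)))

/-- The root of a plane binary tree. -/
def root : (t : BinTree) → Pos t
  | leaf => ()
  | node _ _ => none

/-- The leftmost leaf of a plane binary tree. -/
def first : (t : BinTree) → Pos t
  | leaf => ()
  | node l _ => some (Sum.inl (first l))

/-- The rightmost leaf of a plane binary tree. -/
def last : (t : BinTree) → Pos t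
  | leaf => ()
  | node _ r => some (Sum.inr (last r))

/-- Adjacency in the graph that consists of a plane binary tree and the path through its leaves
from left to right. -/
def Adj : (t : BinTree) → Pos t → Pos t → Prop
  | leaf, _, _ => False
  | node _ _, none, none => False
  | node l _, none, some (Sum.inl y) => y = root l
  | node _ r, none, some (Sum.inr y) => y = root r
  | node l _, some (Sum.inl x), none => x = root l
  | node _ r, some (Sum.inr x), none => x = root r
  | node l _, some (Sum.inl x), some (Sum.inl y) => Adj l x y
  | node _ r, some (Sum.inr x), some (Sum.inr y) => Adj r x y
  | node l r, some (Sum.inl x), some (Sum.inr y) => x = last l ∧ y = first r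
  | node l r, some (Sum.inr x), some (Sum.inl y) => y = last l ∧ x = first r

instance decidableAdj : (t : BinTree) → (x y : Pos t) → Decidable (Adj t x y)
  | leaf, _, _ => inferInstanceAs (Decidable False)
  | node _ _, none, none => inferInstanceAs (Decidable False)
  | node l _, none, some (Sum.inl y) => inferInstanceAs (Decidable (y = root l))
  | node _ r, none, some (Sum.inr y) => inferInstanceAs (Decidable (y = root r))
  | node l _, some (Sum.inl x), none => inferInstanceAs (Decidable (x = root l))
  | node _ r, some (Sum.inr x), none => inferInstanceAs (Decidable (x = root r))
  | node l _, some (Sum.inl x), some (Sum.inl y) => decidableAdj l x y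
  | node _ r, some (Sum.inr x), some (Sum.inr y) => decidableAdj r x y
  | node l r, some (Sum.inl x), some (Sum.inr y) =>
    inferInstanceAs (Decidable (x = last l ∧ y = first r))
  | node l r, some (Sum.inr x), some (Sum.inl y) =>
    inferInstanceAs (Decidable (y = last l ∧ x = first r))

theorem adj_symm : (t : BinTree) → (x y : Pos t) → Adj t x y → Adj t y x
  | node _ _, none, some (Sum.inl _), h => h
  | node _ _, none, some (Sum.inr _), h => h
  | node _ _, some (Sum.inl _), none, h => h
  | node _ _, some (Sum.inr _), none, h => h
  | node l _, some (Sum.inl x), some (Sum.inl y), h => adj_symm l x y h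
  | node _ r, some (Sum.inr x), some (Sum.inr y), h => adj_symm r x y h
  | node _ _, some (Sum.inl _), some (Sum.inr _), h => h
  | node _ _, some (Sum.inr _), some (Sum.inl _), h => h

theorem adj_irrefl : (t : BinTree) → (x : Pos t) → ¬ Adj t x x
  | leaf, _, h => h
  | node _ _, none, h => h
  | node l _, some (Sum.inl x), h => adj_irrefl l x h
  | node _ r, some (Sum.inr x), h => adj_irrefl r x h

/-- The Halin graph whose plane tree is obtained from a plane binary tree by attaching one more
leaf, `none`, to the root. -/
def halin (t : BinTree) : SimpleGraph (Option (Pos t)) where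
  Adj
    | none, none => False
    | none, some y => y = root t ∨ y = first t ∨ y = last t
    | some x, none => x = root t ∨ x = first t ∨ x = last t
    | some x, some y => Adj t x y
  symm := ⟨by
    rintro (_ | x) (_ | y) h
    · exact h
    · exact h
    · exact h
    · exact adj_symm t x y h⟩
  loopless := ⟨by
    rintro (_ | x) h
    · exact h
    · exact adj_irrefl t x h⟩

instance (t : BinTree) : DecidableRel (halin t).Adj
  | none, none => inferInstanceAs (Decidable False)
  | none, some y => inferInstanceAs (Decidable (y = root t ∨ y = first t ∨ y = last t))
  | some x, none => inferInstanceAs (Decidable (x = root t ∨ x = first t ∨ x = last t))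
  | some x, some y => decidableAdj t x y

section Node

variable {l r : BinTree}

/-- The inclusion of the left subtree. -/
def inl (x : Pos l) : Pos (node l r) :=
  some (Sum.inl x)

/-- The inclusion of the right subtree. -/
def inr (x : Pos r) : Pos (node l r) :=
  some (Sum.inr x)

theorem pos_node_cases {p : Pos (node l r) → Prop} (h : p (root _)) (hl : ∀ x, p (inl x))
    (hr : ∀ x, p (inr x)) (x : Pos (node l r)) : p x :=
  match x with
  | none => h
  | some (Sum.inl x) => hl x
  | some (Sum.inr x) => hr x

theorem sum_pos_node (f : Pos (node l r) → ℕ) :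
    ∑ x, f x = f (root _) + (∑ x, f (inl x) + ∑ x, f (inr x)) := by
  refine (Fintype.sum_option (α := Pos l ⊕ Pos r) f).trans ?_
  rw [Fintype.sum_sum_type]
  rfl

theorem node_inl_eq_first (x : Pos l) :
    (inl x : Pos (node l r)) = first (node l r) ↔ x = first l := by
  refine ⟨fun h => ?_, fun h => h ▸ rfl⟩
  exact Sum.inl_injective (Option.some_injective _ h)

theorem node_inr_eq_last (x : Pos r) :
    (inr x : Pos (node l r)) = last (node l r) ↔ x = last r := by
  refine ⟨fun h => ?_, fun h => h ▸ rfl⟩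
  exact Sum.inr_injective (Option.some_injective _ h)

theorem node_inl_ne_last (x : Pos l) :
    (inl x : Pos (node l r)) ≠ last (node l r) := by
  intro h
  exact Sum.inl_ne_inr (Option.some_injective _ h)

theorem node_inr_ne_first (x : Pos r) :
    (inr x : Pos (node l r)) ≠ first (node l r) := by
  intro h
  exact Sum.inr_ne_inl (Option.some_injective _ h)

theorem node_inl_ne_root (x : Pos l) : (inl x : Pos (node l r)) ≠ root (node l r) :=
  Option.some_ne_none _

theorem node_inr_ne_root (x : Pos r) : (inr x : Pos (node l r)) ≠ root (node l r) :=
  Option.some_ne_none _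

theorem node_root_ne_first : root (node l r) ≠ first (node l r) :=
  (Option.some_ne_none _).symm

theorem node_root_ne_last : root (node l r) ≠ last (node l r) :=
  (Option.some_ne_none _).symm

theorem node_first_ne_last : first (node l r) ≠ last (node l r) :=
  node_inl_ne_last _

theorem sum_adj_root (w : Pos (node l r) → ℕ) :
    ∑ y, (if Adj (node l r) (root (node l r)) y then w y else 0) =
      w (inl (root l)) + w (inr (root r)) := by
  rw [sum_pos_node]
  change (if False then _ else 0) + (∑ x, (if x = root l then _ else 0) +
    ∑ x, (if x = root r then _ else 0)) = _
  simp

/-- In the larger piece, the dangling edges of the left piece at its root and its last leaf become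
the edges to the new root and to the first leaf on the right; only the one at the first leaf stays
dangling. The weight `w` is arbitrary, so that the same formula serves for counting degrees and for
counting the edges of one colour. -/
theorem sum_adj_inl (w : Pos (node l r) → ℕ) (x : Pos l) :
    ∑ y, (if Adj (node l r) (inl x) y then w y else 0) =
      (if x = root l then w (root _) else 0) +
        ∑ y, (if Adj l x y then w (inl y) else 0) +
        (if x = last l then w (inr (first r)) else 0) := by
  rw [sum_pos_node, ← add_assoc]
  congr 1
  change ∑ y, (if x = last l ∧ y = first r then _ else 0) = _
  by_cases h : x = last l <;> simp [h]

theorem sum_adj_inr (w : Pos (node l r) → ℕ) (x : Pos r) :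
    ∑ y, (if Adj (node l r) (inr x) y then w y else 0) =
      (if x = root r then w (root _) else 0) +
        ∑ y, (if Adj r x y then w (inr y) else 0) +
        (if x = first r then w (inl (last l)) else 0) := by
  rw [sum_pos_node, add_comm (∑ x, _) (∑ x, _), ← add_assoc]
  congr 1
  change ∑ y, (if y = last l ∧ x = first r then _ else 0) = _
  by_cases h : x = first r <;> simp [h]

end Node

/-- Together with the dangling edges every vertex has degree three. Separate indicators for the
three dangling edges make this true for a single leaf as well, where all three hang on the same
vertex. -/
theorem sum_adj (t : BinTree) (x : Pos t) :
    (∑ y, if Adj t x y then 1 else 0) + (if x = root t then 1 else 0) +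
      (if x = first t then 1 else 0) + (if x = last t then 1 else 0) = 3 := by
  induction t with
  | leaf => cases x; rfl
  | node l r hl hr =>
    induction x using pos_node_cases with
    | h =>
      rw [sum_adj_root fun _ => 1, if_pos rfl, if_neg node_root_ne_first, if_neg node_root_ne_last]
    | hl x =>
      have := hl x
      rw [sum_adj_inl fun _ => 1, if_neg (node_inl_ne_root x), if_neg (node_inl_ne_last x),
        if_congr (node_inl_eq_first x) rfl rfl]
      omega
    | hr x =>
      have := hr x
      rw [sum_adj_inr fun _ => 1, if_neg (node_inr_ne_root x), if_neg (node_inr_ne_first x),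
        if_congr (node_inr_eq_last x) rfl rfl]
      omega

theorem halin_isRegularOfDegree {t : BinTree} (ht : t ≠ leaf) :
    (halin t).IsRegularOfDegree 3 := by
  obtain _ | ⟨l, r⟩ := t
  · exact absurd rfl ht
  have h1 := node_root_ne_first (l := l) (r := r)
  have h2 := node_root_ne_last (l := l) (r := r)
  have h3 := node_first_ne_last (l := l) (r := r)
  intro x
  rw [← SimpleGraph.card_neighborFinset_eq_degree, SimpleGraph.neighborFinset_eq_filter,
    Finset.card_filter, Fintype.sum_option]
  cases x with
  | none =>
    change (if False then 1 else 0) + ∑ y, (if y = _ ∨ y = _ ∨ y = _ then 1 else 0) = 3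
    rw [← Finset.card_filter, if_neg id, zero_add, Finset.card_eq_three]
    refine ⟨_, _, _, h1, h2, h3, ?_⟩
    ext y
    simp
  | some x =>
    change (if x = _ ∨ x = _ ∨ x = _ then 1 else 0) + ∑ y, (if Adj _ x y then 1 else 0) = 3
    have := sum_adj _ x
    by_cases h : x = root (node l r)
    · subst h
      simp only [true_or, if_true, if_neg h1, if_neg h2] at this ⊢
      omega
    by_cases h' : x = first (node l r)
    · subst h'
      simp only [true_or, or_true, if_true, if_neg h3, if_neg h] at this ⊢
      omega
    simp only [h, h', false_or, if_false] at this ⊢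
    omega

end BinTree

/-! ### Homomorphisms of regular graphs and distances in trees -/

/-- An injective homomorphism from a nonempty regular graph to a connected regular graph of the
same degree is an isomorphism. -/
theorem nonempty_iso_of_injective_hom {V W : Type*} [Fintype V] [Fintype W] [Nonempty W]
    {G : SimpleGraph W} {H : SimpleGraph V} [DecidableRel G.Adj] [DecidableRel H.Adj] {k : ℕ}
    (hG : G.IsRegularOfDegree k) (hH : H.IsRegularOfDegree k) (hc : H.Connected) (f : W → V)
    (hf : Function.Injective f) (hom : ∀ x y, G.Adj x y → H.Adj (f x) (f y)) :
    Nonempty (G ≃g H) := by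
  classical
  -- Both sets have `k` elements, so the inclusion is an equality. The image of `f` is then closed
  -- under adjacency, and connectedness makes `f` surjective.
  have key (x : W) : (G.neighborFinset x).image f = H.neighborFinset (f x) := by
    refine Finset.eq_of_subset_of_card_le ?_ ?_
    · intro v hv
      obtain ⟨y, hy, rfl⟩ := Finset.mem_image.1 hv
      exact (H.mem_neighborFinset _ _).2 (hom _ _ ((G.mem_neighborFinset _ _).1 hy))
    · rw [Finset.card_image_of_injective _ hf, SimpleGraph.card_neighborFinset_eq_degree,
        SimpleGraph.card_neighborFinset_eq_degree, hG, hH]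
  have adj_image (x : W) (v : V) (h : H.Adj (f x) v) : ∃ y, G.Adj x y ∧ f y = v := by
    have : v ∈ (G.neighborFinset x).image f := by rwa [key, H.mem_neighborFinset]
    simpa using this
  have surj : Function.Surjective f := by
    intro v
    obtain ⟨w⟩ := ‹Nonempty W›
    induction (SimpleGraph.reachable_iff_reflTransGen _ _).1 (hc.preconnected (f w) v) with
    | refl => exact ⟨w, rfl⟩
    | tail _ h ih =>
      obtain ⟨x, rfl⟩ := ih
      obtain ⟨y, -, hy⟩ := adj_image x _ h
      exact ⟨y, hy⟩
  refine ⟨⟨Equiv.ofBijective f ⟨hf, surj⟩, fun {x y} => ⟨fun h => ?_, hom x y⟩⟩⟩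
  obtain ⟨z, hz, hzy⟩ := adj_image x _ h
  rwa [← hf hzy]

open BinTree

/-- In a tree, the neighbour of a vertex that is nearer to a fixed vertex is unique. -/
theorem exists_parent {V : Type*} {T : SimpleGraph V} (hT : T.IsTree) (v₀ : V) :
    ∃ parent : V → V, ∀ u w, T.Adj u w → T.dist v₀ w = T.dist v₀ u + 1 → parent w = u := by
  classical
  -- Shortest walks to `u` and to `u'`, prolonged to `w`, are shortest again, hence paths; a tree
  -- has only one path to `w`.
  have unique (u u' w : V) (h : T.Adj u w) (h' : T.Adj u' w)
      (hd : T.dist v₀ w = T.dist v₀ u + 1) (hd' : T.dist v₀ w = T.dist v₀ u' + 1) : u = u' := by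
    obtain ⟨p, hp⟩ := hT.connected.exists_walk_length_eq_dist v₀ u
    obtain ⟨q, hq⟩ := hT.connected.exists_walk_length_eq_dist v₀ u'
    have hp' : (p.concat h).IsPath :=
      SimpleGraph.Walk.isPath_of_length_eq_dist _ (by rw [SimpleGraph.Walk.length_concat, hp, hd])
    have hq' : (q.concat h').IsPath :=
      SimpleGraph.Walk.isPath_of_length_eq_dist _ (by rw [SimpleGraph.Walk.length_concat, hq, hd'])
    have := congrArg SimpleGraph.Walk.penultimate
      ((hT.existsUnique_path v₀ w).unique hp' hq')
    simpa using this
  refine ⟨fun w => if h : ∃ u, T.Adj u w ∧ T.dist v₀ w = T.dist v₀ u + 1 then h.choose else w,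
    fun u w h hd => ?_⟩
  have hex : ∃ u, T.Adj u w ∧ T.dist v₀ w = T.dist v₀ u + 1 := ⟨u, h, hd⟩
  refine (dif_pos hex).trans ?_
  exact unique _ _ _ hex.choose_spec.1 h hex.choose_spec.2 hd

theorem dist_lt_card {V : Type*} [Fintype V] {T : SimpleGraph V} (hT : T.Connected) (u v : V) :
    T.dist u v < Fintype.card V := by
  obtain ⟨p, hp, h⟩ := hT.exists_path_of_dist u v
  exact h ▸ hp.length_lt

/-! ### Unfolding a cubic plane tree from a leaf -/

namespace RotationSystem

variable {V : Type*} {T : SimpleGraph V} (R : RotationSystem T)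

/-- Every vertex that is not a leaf has exactly three darts. -/
def IsCubic : Prop :=
  ∀ d : T.Dart, ¬ IsLeaf T d.fst →
    R.rot d ≠ d ∧ R.rot (R.rot d) ≠ d ∧ R.rot (R.rot (R.rot d)) = d

theorem dart_ext {d e : T.Dart} (h : d.fst = e.fst) (h' : d.snd = e.snd) : d = e :=
  SimpleGraph.Dart.ext _ _ (Prod.ext h h')

theorem fst_faceStep (d : T.Dart) : (R.faceStep d).fst = d.snd :=
  R.fst_rot d.symm

theorem isCubic_of_forall_card [Fintype V] [DecidableRel T.Adj]
    (h : ∀ v, ¬ IsLeaf T v → T.degree v = 3) : R.IsCubic := by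
  classical
  intro d hd
  have hcard : (Finset.univ.filter fun e : T.Dart => e.fst = d.fst).card = 3 := by
    rw [← h _ hd, ← T.dart_fst_fiber_card_eq_degree]
  -- All darts at a vertex lie on one cycle of `rot`, so a set that contains `d` and is closed under
  -- `rot` contains all three of them. This excludes cycles of length one and two; a cycle longer
  -- than three would give four darts at the vertex.
  have hsub (s : Finset T.Dart) (hds : d ∈ s) (hs : ∀ e ∈ s, R.rot e ∈ s) : 3 ≤ s.card := by
    rw [← hcard]
    refine Finset.card_le_card fun e he => ?_
    obtain ⟨n, hn⟩ := (R.sameCycle d e (Finset.mem_filter.1 he).2.symm).exists_nat_pow_eq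
    rw [← hn]
    clear hn he
    induction n with
    | zero => exact hds
    | succ n ih =>
      rw [pow_succ']
      exact hs _ ih
  have h1 : R.rot d ≠ d := by
    intro h1
    have := hsub {d} (by simp) (by simp [h1])
    simp at this
  have h2 : R.rot (R.rot d) ≠ d := by
    intro h2
    have := (hsub {d, R.rot d} (by simp) (by simp [h2])).trans Finset.card_le_two
    omega
  refine ⟨h1, h2, ?_⟩
  by_contra h3
  have h12 : R.rot d ≠ R.rot (R.rot d) := fun h => h1 (R.rot.injective h).symm
  have h23 : R.rot (R.rot d) ≠ R.rot (R.rot (R.rot d)) := fun h => h12 (R.rot.injective h)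
  have h13 : R.rot d ≠ R.rot (R.rot (R.rot d)) := fun h => h2 (R.rot.injective h).symm
  have hle := Finset.card_le_card (s := {d, R.rot d, R.rot (R.rot d), R.rot (R.rot (R.rot d))})
    (t := Finset.univ.filter fun e : T.Dart => e.fst = d.fst)
    (by intro e he
        simp only [Finset.mem_insert, Finset.mem_singleton] at he
        simp only [Finset.mem_filter, Finset.mem_univ, true_and]
        obtain rfl | rfl | rfl | rfl := he <;> simp [R.fst_rot])
  rw [hcard, Finset.card_insert_of_notMem (by simp [h1.symm, h2.symm, Ne.symm h3]),
    Finset.card_insert_of_notMem (by simp [h12, h13]),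
    Finset.card_insert_of_notMem (by simpa using h23), Finset.card_singleton] at hle
  omega

/-- The plane binary tree `t` is what lies beyond the dart `d`. -/
def Unfolds : BinTree → T.Dart → Prop
  | leaf, d => IsLeaf T d.snd
  | node l r, d =>
    ¬ IsLeaf T d.snd ∧ Unfolds l (R.faceStep d) ∧ Unfolds r (R.rot (R.faceStep d))

/-- The vertices of the part of the tree beyond a dart, as vertices of a binary tree. -/
def place : (t : BinTree) → T.Dart → Pos t → V
  | leaf, d, _ => d.snd
  | node _ _, d, none => d.snd
  | node l _, d, some (Sum.inl x) => place l (R.faceStep d) x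
  | node _ r, d, some (Sum.inr x) => place r (R.rot (R.faceStep d)) x

theorem place_root (t : BinTree) (d : T.Dart) : R.place t d (root t) = d.snd := by
  cases t <;> rfl

section Depth

variable {R} {depth : V → ℕ} {parent : V → V}

/-- A function on the vertices that changes by one along every edge, and the function that maps
each vertex to its only neighbour with a smaller value. -/
structure IsDepth (T : SimpleGraph V) (depth : V → ℕ) (parent : V → V) : Prop where
  adj : ∀ u w, T.Adj u w → depth w = depth u + 1 ∨ depth u = depth w + 1
  parent_eq : ∀ u w, T.Adj u w → depth w = depth u + 1 → parent w = u

/-- A dart that leaves `d.snd` upwards ends at the parent of `d.snd`, which is `d.fst`, and so is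
the reversal of `d`. -/
theorem IsDepth.descends (h : IsDepth T depth parent) {d e : T.Dart}
    (hd : depth d.snd = depth d.fst + 1) (he : e.fst = d.snd) (hne : e ≠ d.symm) :
    depth e.snd = depth e.fst + 1 := by
  refine (h.adj _ _ e.adj).resolve_right fun h' => hne (dart_ext he ?_)
  exact (h.parent_eq _ _ e.adj.symm h').symm.trans (he ▸ h.parent_eq _ _ d.adj hd)

theorem IsDepth.descends_faceStep (h : IsDepth T depth parent) (hR : R.IsCubic) {d : T.Dart}
    (hd : depth d.snd = depth d.fst + 1) (hl : ¬ IsLeaf T d.snd) :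
    depth (R.faceStep d).snd = depth (R.faceStep d).fst + 1 :=
  h.descends hd (R.fst_faceStep d) (hR d.symm hl).1

theorem IsDepth.descends_rot_faceStep (h : IsDepth T depth parent) (hR : R.IsCubic) {d : T.Dart}
    (hd : depth d.snd = depth d.fst + 1) (hl : ¬ IsLeaf T d.snd) :
    depth (R.rot (R.faceStep d)).snd = depth (R.rot (R.faceStep d)).fst + 1 :=
  h.descends hd ((R.fst_rot _).trans (R.fst_faceStep d)) (hR d.symm hl).2.1

/-- Beyond `d` the depth grows with every step and is bounded by `N`, so the unfolding ends. -/
theorem IsDepth.exists_unfolds (h : IsDepth T depth parent) (hR : R.IsCubic) {N : ℕ}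
    (hN : ∀ v, depth v < N) (d : T.Dart) (hd : depth d.snd = depth d.fst + 1) :
    ∃ t, R.Unfolds t d := by
  induction hk : N - depth d.snd using Nat.strong_induction_on generalizing d with
  | _ k ih =>
    by_cases hl : IsLeaf T d.snd
    · exact ⟨leaf, hl⟩
    have h1 := h.descends_faceStep hR hd hl
    have h2 := h.descends_rot_faceStep hR hd hl
    have e1 := congrArg depth (R.fst_faceStep d)
    have e2 := congrArg depth ((R.fst_rot _).trans (R.fst_faceStep d))
    have := hN d.snd
    obtain ⟨l, hl'⟩ := ih _ (by omega) _ h1 rfl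
    obtain ⟨r, hr'⟩ := ih _ (by omega) _ h2 rfl
    exact ⟨node l r, hl, hl', hr'⟩

/-- The second part makes the induction for injectivity work: the depth of a vertex tells how many
steps to the parent lead back to `d.snd`, so a vertex remembers the subtree in which it lies. -/
theorem IsDepth.place_spec (h : IsDepth T depth parent) (hR : R.IsCubic) (t : BinTree)
    (d : T.Dart) (hd : depth d.snd = depth d.fst + 1) (ht : R.Unfolds t d) :
    Function.Injective (R.place t d) ∧
      ∀ x, ∃ k, parent^[k] (R.place t d x) = d.snd ∧
        depth (R.place t d x) = depth d.snd + k := by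
  induction t generalizing d with
  | leaf => exact ⟨fun _ _ _ => rfl, fun _ => ⟨0, rfl, rfl⟩⟩
  | node l r ihl ihr =>
    obtain ⟨hl, htl, htr⟩ := ht
    have h1 := h.descends_faceStep hR hd hl
    have h2 := h.descends_rot_faceStep hR hd hl
    have f1 := R.fst_faceStep d
    have f2 := (R.fst_rot _).trans (R.fst_faceStep d)
    have e1 := congrArg depth f1
    have e2 := congrArg depth f2
    obtain ⟨injl, pl⟩ := ihl _ h1 htl
    obtain ⟨injr, pr⟩ := ihr _ h2 htr
    have hdisj (x : Pos l) (y : Pos r) :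
        R.place l (R.faceStep d) x ≠ R.place r (R.rot (R.faceStep d)) y := by
      intro hxy
      obtain ⟨k, hk, hk'⟩ := pl x
      obtain ⟨j, hj, hj'⟩ := pr y
      rw [hxy] at hk hk'
      -- The two children of `d.snd` have the same depth. A common vertex thus reaches both after
      -- equally many steps, and the two darts to them would coincide.
      obtain rfl : k = j := by omega
      refine (hR d.symm hl).1 (R.rot.injective ?_)
      exact dart_ext (f2.trans f1.symm) (hj.symm.trans hk)
    have hdl (x : Pos l) : d.snd ≠ R.place l (R.faceStep d) x := by
      intro hx
      obtain ⟨k, -, hk⟩ := pl x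
      rw [← hx] at hk
      omega
    have hdr (x : Pos r) : d.snd ≠ R.place r (R.rot (R.faceStep d)) x := by
      intro hx
      obtain ⟨k, -, hk⟩ := pr x
      rw [← hx] at hk
      omega
    constructor
    · intro x y hxy
      match x, y with
      | none, none => rfl
      | none, some (Sum.inl y) => exact absurd hxy (hdl y)
      | none, some (Sum.inr y) => exact absurd hxy (hdr y)
      | some (Sum.inl x), none => exact absurd hxy.symm (hdl x)
      | some (Sum.inr x), none => exact absurd hxy.symm (hdr x)
      | some (Sum.inl x), some (Sum.inl y) =>
        exact congrArg (fun z => (some (Sum.inl z) : Option (Pos l ⊕ Pos r))) (injl hxy)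
      | some (Sum.inr x), some (Sum.inr y) =>
        exact congrArg (fun z => (some (Sum.inr z) : Option (Pos l ⊕ Pos r))) (injr hxy)
      | some (Sum.inl x), some (Sum.inr y) => exact absurd hxy (hdisj x y)
      | some (Sum.inr x), some (Sum.inl y) => exact absurd hxy.symm (hdisj y x)
    · intro x
      match x with
      | none => exact ⟨0, rfl, rfl⟩
      | some (Sum.inl x) =>
        obtain ⟨k, hk, hk'⟩ := pl x
        refine ⟨k + 1, ?_, ?_⟩
        · rw [Function.iterate_succ_apply']
          exact (congrArg parent hk).trans ((h.parent_eq _ _ (R.faceStep d).adj h1).trans f1)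
        · change depth (R.place l (R.faceStep d) x) = _
          omega
      | some (Sum.inr x) =>
        obtain ⟨k, hk, hk'⟩ := pr x
        refine ⟨k + 1, ?_, ?_⟩
        · rw [Function.iterate_succ_apply']
          exact (congrArg parent hk).trans
            ((h.parent_eq _ _ (R.rot (R.faceStep d)).adj h2).trans f2)
        · change depth (R.place r (R.rot (R.faceStep d)) x) = _
          omega

end Depth

/-- The walk around the plane tree that starts with the dart `d` comes to the dart `e` without
passing through a leaf in between. -/
def Runs (d e : T.Dart) : Prop :=
  ∃ k, R.faceStep^[k] d = e ∧ ∀ i < k, ¬ IsLeaf T (R.faceStep^[i] d).snd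

variable {R}

theorem Runs.refl (d : T.Dart) : R.Runs d d :=
  ⟨0, rfl, fun _ h => absurd h (Nat.not_lt_zero _)⟩

theorem Runs.trans {d e f : T.Dart} (h : R.Runs d e) (he : ¬ IsLeaf T e.snd)
    (h' : R.Runs (R.faceStep e) f) : R.Runs d f := by
  obtain ⟨k, rfl, hk⟩ := h
  obtain ⟨j, rfl, hj⟩ := h'
  have hit (i : ℕ) : R.faceStep^[i + (k + 1)] d =
      R.faceStep^[i] (R.faceStep (R.faceStep^[k] d)) := by
    rw [Function.iterate_add_apply, Function.iterate_succ_apply']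
  refine ⟨j + (k + 1), hit j, fun i hi => ?_⟩
  obtain hik | rfl | hik := lt_trichotomy i k
  · exact hk i hik
  · exact he
  · obtain ⟨m, rfl⟩ := Nat.exists_eq_add_of_le' hik
    rw [hit]
    exact hj m (by omega)

/-- At each inner vertex the face step continues into the left subtree, so the walk follows the
leftmost branch. -/
theorem Unfolds.runs_first (t : BinTree) (d : T.Dart) (h : R.Unfolds t d) :
    IsLeaf T (R.place t d (first t)) ∧ ∃ e, R.Runs d e ∧ e.snd = R.place t d (first t) := by
  induction t generalizing d with
  | leaf => exact ⟨h, d, Runs.refl d, rfl⟩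
  | node l r ihl ihr =>
    obtain ⟨hl, htl, htr⟩ := h
    obtain ⟨h1, e, he, h2⟩ := ihl _ htl
    exact ⟨h1, e, (Runs.refl d).trans hl he, h2⟩

/-- On the way up from a right subtree, the next dart is the third one at the vertex, which leads
further up; so the walk from the last leaf climbs the rightmost branch. -/
theorem Unfolds.runs_last (hR : R.IsCubic) (t : BinTree) (d : T.Dart) (h : R.Unfolds t d) :
    IsLeaf T (R.place t d (last t)) ∧
      ∃ e : T.Dart, e.fst = R.place t d (last t) ∧ R.Runs e d.symm := by
  induction t generalizing d with
  | leaf => exact ⟨h, d.symm, rfl, Runs.refl _⟩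
  | node l r ihl ihr =>
    obtain ⟨hl, htl, htr⟩ := h
    obtain ⟨h1, e, he, h2⟩ := ihr _ htr
    have hs : (R.rot (R.faceStep d)).symm.snd = d.snd := (R.fst_rot _).trans (R.fst_faceStep d)
    refine ⟨h1, e, he, h2.trans (hs ▸ hl) ?_⟩
    have : R.faceStep (R.rot (R.faceStep d)).symm = d.symm := (hR d.symm hl).2.2
    rw [this]
    exact Runs.refl _

theorem nextLeaf_of_runs {d e : T.Dart} (hd : IsLeaf T d.fst) (he : IsLeaf T e.snd)
    (h : R.Runs d e) : R.NextLeaf d.fst e.snd := by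
  obtain ⟨k, rfl, hk⟩ := h
  exact ⟨hd, he, d, k, rfl, rfl, hk⟩

/-- The walk climbs from the last leaf of the left subtree to the common vertex, turns into the
right subtree and descends to its first leaf. -/
theorem Unfolds.nextLeaf_last_first (hR : R.IsCubic) (l r : BinTree) (d : T.Dart)
    (h : R.Unfolds (node l r) d) :
    R.NextLeaf (R.place l (R.faceStep d) (last l))
      (R.place r (R.rot (R.faceStep d)) (first r)) := by
  obtain ⟨hl, htl, htr⟩ := h
  obtain ⟨h1, e, he, h2⟩ := runs_last hR l _ htl
  obtain ⟨h3, f, hf, h4⟩ := runs_first r _ htr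
  rw [← he, ← h4]
  refine nextLeaf_of_runs (he ▸ h1) (h4 ▸ h3) (h2.trans (e := (R.faceStep d).symm) ?_ hf)
  change ¬ IsLeaf T (R.faceStep d).fst
  rwa [R.fst_faceStep]

theorem Unfolds.adj_place (hR : R.IsCubic) (t : BinTree) (d : T.Dart) (h : R.Unfolds t d)
    (hinj : Function.Injective (R.place t d)) (x y : Pos t) (hxy : Adj t x y) :
    (T ⊔ R.leafCycle).Adj (R.place t d x) (R.place t d y) := by
  induction t generalizing d with
  | leaf => exact hxy.elim
  | node l r ihl ihr =>
    have hnext := h.nextLeaf_last_first hR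
    obtain ⟨hl, htl, htr⟩ := h
    have adjl : T.Adj d.snd (R.place l (R.faceStep d) (root l)) := by
      rw [R.place_root, ← R.fst_faceStep d]
      exact (R.faceStep d).adj
    have adjr : T.Adj d.snd (R.place r (R.rot (R.faceStep d)) (root r)) := by
      rw [R.place_root, ← R.fst_faceStep d, ← R.fst_rot]
      exact (R.rot (R.faceStep d)).adj
    have injl : Function.Injective (R.place l (R.faceStep d)) := fun a b hab =>
      Sum.inl_injective (Option.some_injective _
        (@hinj (some (Sum.inl a)) (some (Sum.inl b)) hab))
    have injr : Function.Injective (R.place r (R.rot (R.faceStep d))) := fun a b hab =>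
      Sum.inr_injective (Option.some_injective _
        (@hinj (some (Sum.inr a)) (some (Sum.inr b)) hab))
    have cross : R.leafCycle.Adj (R.place l (R.faceStep d) (last l))
        (R.place r (R.rot (R.faceStep d)) (first r)) := by
      refine (SimpleGraph.fromRel_adj _ _ _).2 ⟨fun hab => ?_, Or.inl hnext⟩
      exact Sum.inl_ne_inr (Option.some_injective _
        (@hinj (some (Sum.inl (last l))) (some (Sum.inr (first r))) hab))
    match x, y, hxy with
    | none, some (Sum.inl _), rfl => exact Or.inl adjl
    | none, some (Sum.inr _), rfl => exact Or.inl adjr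
    | some (Sum.inl _), none, rfl => exact Or.inl adjl.symm
    | some (Sum.inr _), none, rfl => exact Or.inl adjr.symm
    | some (Sum.inl x), some (Sum.inl y), hxy => exact ihl _ htl injl x y hxy
    | some (Sum.inr x), some (Sum.inr y), hxy => exact ihr _ htr injr x y hxy
    | some (Sum.inl _), some (Sum.inr _), ⟨rfl, rfl⟩ => exact Or.inr cross
    | some (Sum.inr _), some (Sum.inl _), ⟨rfl, rfl⟩ => exact Or.inr cross.symm

end RotationSystem

open RotationSystem in
/-- Every cubic Halin graph is the Halin graph of a plane binary tree. -/
theorem exists_iso_halin {V : Type*} [Fintype V] {H : SimpleGraph V} [DecidableRel H.Adj]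
    (hreg : H.IsRegularOfDegree 3) (hH : IsHalin H) :
    ∃ t, t ≠ leaf ∧ Nonempty (halin t ≃g H) := by
  classical
  obtain ⟨T, R, hT, hleaves, rfl⟩ := hH
  -- The leaf cycle has no edge at a vertex that is not a leaf of `T`, so such a vertex keeps all
  -- three edges within `T`.
  have hR : R.IsCubic := by
    refine R.isCubic_of_forall_card fun v hv => ?_
    have hdeg := hreg v
    rw [← SimpleGraph.card_neighborFinset_eq_degree] at hdeg ⊢
    rw [← hdeg]
    congr 1
    ext w
    have : ¬ R.leafCycle.Adj v w := by
      rintro ⟨-, h | h⟩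
      · exact hv h.1
      · exact hv h.2.1
    simp [this]
  obtain ⟨v₀, hv₀⟩ : {v | IsLeaf T v}.Nonempty := by
    rw [← Set.ncard_pos]
    omega
  obtain ⟨w₀, hw₀, -⟩ := id hv₀
  obtain ⟨parent, hparent⟩ := exists_parent hT v₀
  have hdepth : IsDepth T (T.dist v₀) parent :=
    ⟨fun u w h => (hT.dist_eq_dist_add_one_of_adj v₀ h).symm, hparent⟩
  let d : T.Dart := ⟨(v₀, w₀), hw₀⟩
  have hd : T.dist v₀ d.snd = T.dist v₀ d.fst + 1 := by
    change T.dist v₀ w₀ = T.dist v₀ v₀ + 1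
    rw [SimpleGraph.dist_self, SimpleGraph.dist_eq_one_iff_adj.2 hw₀]
  obtain ⟨t, ht⟩ := hdepth.exists_unfolds hR (dist_lt_card hT.connected v₀) d hd
  obtain ⟨hinj, hplace⟩ := hdepth.place_spec hR t d hd ht
  -- If both ends of `d` were leaves, the tree would be a single edge and have at most two leaves.
  have htl : t ≠ leaf := by
    rintro rfl
    have hsub : (Set.univ : Set V) ⊆ {v₀, w₀} := by
      intro v _
      induction (SimpleGraph.reachable_iff_reflTransGen _ _).1 (hT.connected.preconnected v₀ v) with
      | refl => exact Or.inl rfl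
      | tail _ h ih =>
        obtain h' | h' := ih (Set.mem_univ _)
        · exact Or.inr (hv₀.unique (h' ▸ h) hw₀)
        · exact Or.inl (ExistsUnique.unique (p := T.Adj w₀) ht (h' ▸ h) hw₀.symm)
    have := Set.ncard_le_ncard ((Set.subset_univ {v | IsLeaf T v}).trans hsub)
    have := Set.ncard_insert_le v₀ {w₀}
    rw [Set.ncard_singleton] at this
    omega
  have hne (x : Pos t) : v₀ ≠ R.place t d x := by
    intro hx
    obtain ⟨k, -, hk⟩ := hplace x
    rw [← hx, SimpleGraph.dist_self] at hk
    omega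
  have nextFirst : R.NextLeaf v₀ (R.place t d (first t)) := by
    obtain ⟨h1, e, h2, h3⟩ := ht.runs_first
    exact h3 ▸ nextLeaf_of_runs (d := d) hv₀ (h3 ▸ h1) h2
  have nextLast : R.NextLeaf (R.place t d (last t)) v₀ := by
    obtain ⟨h1, e, h2, h3⟩ := ht.runs_last hR
    exact h2 ▸ nextLeaf_of_runs (e := d.symm) (h2 ▸ h1) hv₀ h3
  have hnone (x : Pos t) (hx : x = root t ∨ x = first t ∨ x = last t) :
      (T ⊔ R.leafCycle).Adj v₀ (R.place t d x) := by
    obtain rfl | rfl | rfl := hx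
    · exact Or.inl ((R.place_root t d).symm ▸ hw₀)
    · exact Or.inr ((SimpleGraph.fromRel_adj _ _ _).2 ⟨hne _, Or.inl nextFirst⟩)
    · exact Or.inr ((SimpleGraph.fromRel_adj _ _ _).2 ⟨hne _, Or.inr nextLast⟩)
  -- Edges need to be followed in one direction only: both graphs are cubic and `H` is connected, so
  -- an injective homomorphism is an isomorphism.
  refine ⟨t, htl, nonempty_iso_of_injective_hom (halin_isRegularOfDegree htl) hreg
    (hT.connected.mono le_sup_left) (fun x => x.elim v₀ (R.place t d)) ?_ ?_⟩
  · rintro (_ | x) (_ | y) hxy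
    · rfl
    · exact absurd hxy (hne y)
    · exact absurd hxy.symm (hne x)
    · exact congrArg some (hinj hxy)
  · rintro (_ | x) (_ | y) hxy
    · exact hxy.elim
    · exact hnone y hxy
    · exact (hnone x hxy).symm
    · exact ht.adj_place hR t d hinj x y hxy

/-! ### Total colourings of cubic graphs with four colours -/

/-- The four colours. -/
inductive Color
  | c0 | c1 | c2 | c3
  deriving DecidableEq

instance : Fintype Color where
  elems := {Color.c0, Color.c1, Color.c2, Color.c3}
  complete := by rintro (_ | _ | _ | _) <;> decide

theorem card_color : Fintype.card Color = 4 :=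
  rfl

/-- A total colouring with four colours of a cubic graph, given by the colours of the vertices and
the colours of the edges: at each vertex each colour occurs exactly once. -/
structure IsPainting {W : Type*} [Fintype W] (G : SimpleGraph W) [DecidableRel G.Adj]
    (cv : W → Color) (ce : W → W → Color) : Prop where
  symm : ∀ x y, ce x y = ce y x
  adj : ∀ x y, G.Adj x y → cv x ≠ cv y
  count : ∀ x c, (if cv x = c then 1 else 0) +
    ∑ y, (if G.Adj x y then (if ce x y = c then 1 else 0) else 0) = 1

theorem totalGraph_colorable_of_injective {V W : Type*} {G : SimpleGraph W} {H : SimpleGraph V}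
    {n : ℕ} (f : W → V) (hf : Function.Injective f) (hom : ∀ x y, G.Adj x y → H.Adj (f x) (f y))
    (h : (totalGraph H).Colorable n) : (totalGraph G).Colorable n := by
  obtain ⟨C⟩ := h
  let g : G →g H := ⟨f, fun {x y} => hom x y⟩
  refine ⟨SimpleGraph.Coloring.mk
    (Sum.elim (fun x => C (Sum.inl (f x))) (fun e => C (Sum.inr (g.mapEdgeSet e)))) ?_⟩
  rintro (x | e) (y | e') h
  · exact C.valid (v := Sum.inl (f x)) (w := Sum.inl (f y)) (hom _ _ h)
  · exact C.valid (v := Sum.inl (f x)) (w := Sum.inr (g.mapEdgeSet e'))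
      (Sym2.mem_map.2 ⟨x, h, rfl⟩)
  · exact C.valid (v := Sum.inr (g.mapEdgeSet e)) (w := Sum.inl (f y))
      (Sym2.mem_map.2 ⟨y, h, rfl⟩)
  · obtain ⟨hne, u, hu, hu'⟩ := h
    exact C.valid (v := Sum.inr (g.mapEdgeSet e)) (w := Sum.inr (g.mapEdgeSet e'))
      ⟨fun h => hne (SimpleGraph.Hom.mapEdgeSet.injective g hf h), f u,
        Sym2.mem_map.2 ⟨u, hu, rfl⟩, Sym2.mem_map.2 ⟨u, hu', rfl⟩⟩

theorem totalGraph_colorable_of_forall {W C : Type*} [Fintype C] {G : SimpleGraph W}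
    (cv : W → C) (ce : W → W → C) (symm : ∀ x y, ce x y = ce y x)
    (adj : ∀ x y, G.Adj x y → cv x ≠ cv y) (inc : ∀ x y, G.Adj x y → cv x ≠ ce x y)
    (edge : ∀ x y z, G.Adj x y → G.Adj x z → y ≠ z → ce x y ≠ ce x z) :
    (totalGraph G).Colorable (Fintype.card C) := by
  let col : Sym2 W → C := Sym2.lift ⟨ce, symm⟩
  refine SimpleGraph.Coloring.colorable (G := totalGraph G)
    (SimpleGraph.Coloring.mk (Sum.elim cv fun e => col e) ?_)
  have inc' (x : W) (e : G.edgeSet) (h : x ∈ (e : Sym2 W)) : cv x ≠ col e := by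
    obtain ⟨y, hy⟩ := Sym2.mem_iff_exists.1 h
    have := e.2
    rw [hy, SimpleGraph.mem_edgeSet] at this
    rw [hy]
    exact inc x y this
  rintro (x | e) (y | e') h
  · exact adj x y h
  · exact inc' x e' h
  · exact (inc' y e h).symm
  · obtain ⟨hne, u, hu, hu'⟩ := h
    obtain ⟨y, hy⟩ := Sym2.mem_iff_exists.1 hu
    obtain ⟨z, hz⟩ := Sym2.mem_iff_exists.1 hu'
    have h1 := e.2
    have h2 := e'.2
    rw [hy, SimpleGraph.mem_edgeSet] at h1
    rw [hz, SimpleGraph.mem_edgeSet] at h2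
    change col e ≠ col e'
    rw [hy, hz]
    refine edge u y z h1 h2 ?_
    rintro rfl
    exact hne (Subtype.ext (hy.trans hz.symm))

theorem IsPainting.colorable {W : Type*} [Fintype W] {G : SimpleGraph W} [DecidableRel G.Adj]
    {cv : W → Color} {ce : W → W → Color} (h : IsPainting G cv ce) :
    (totalGraph G).Colorable 4 := by
  classical
  refine totalGraph_colorable_of_forall cv ce h.symm h.adj ?_ ?_
  · intro x y hxy heq
    have := h.count x (cv x)
    have hle := Finset.single_le_sum (f := fun z => if G.Adj x z then
      (if ce x z = cv x then 1 else 0) else 0) (fun _ _ => Nat.zero_le _) (Finset.mem_univ y)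
    simp only [if_pos hxy, if_pos heq.symm] at hle
    rw [if_pos rfl] at this
    omega
  · intro x y z hxy hxz hyz heq
    have := h.count x (ce x z)
    have hle := Finset.sum_le_sum_of_subset (f := fun z' => if G.Adj x z' then
      (if ce x z' = ce x z then 1 else 0) else 0) (Finset.subset_univ {y, z})
    rw [Finset.sum_pair hyz] at hle
    simp only [if_pos hxy, if_pos hxz, if_pos heq, if_true] at hle
    omega

theorem exists_isPainting {W : Type*} [Fintype W] {G : SimpleGraph W} [DecidableRel G.Adj]
    (hG : G.IsRegularOfDegree 3) (h : (totalGraph G).Colorable 4) :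
    ∃ cv ce, IsPainting G cv ce := by
  classical
  obtain ⟨C⟩ := h
  let q : Fin 4 ≃ Color := (Fintype.equivFinOfCardEq card_color).symm
  let cv : W → Color := fun x => q (C (Sum.inl x))
  let ce : W → W → Color := fun x y =>
    if h : G.Adj x y then q (C (Sum.inr ⟨s(x, y), h⟩)) else Color.c0
  have inc (x y : W) (h : G.Adj x y) : cv x ≠ ce x y := by
    simp only [cv, ce, dif_pos h]
    refine q.injective.ne (C.valid (v := Sum.inl x) (w := Sum.inr _) ?_)
    exact Sym2.mem_mk_left x y
  have edge (x y z : W) (h : G.Adj x y) (h' : G.Adj x z) (hyz : y ≠ z) : ce x y ≠ ce x z := by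
    simp only [ce, dif_pos h, dif_pos h']
    refine q.injective.ne (C.valid (v := Sum.inr _) (w := Sum.inr _) ⟨fun h => hyz ?_, x, ?_, ?_⟩)
    · exact Sym2.congr_right.1 (congrArg Subtype.val h)
    · exact Sym2.mem_mk_left x y
    · exact Sym2.mem_mk_left x z
  have le_one (x : W) (c : Color) : (if cv x = c then 1 else 0) +
      ∑ y, (if G.Adj x y then (if ce x y = c then 1 else 0) else 0) ≤ 1 := by
    have hsum : ∑ y, (if G.Adj x y then (if ce x y = c then 1 else 0) else 0) =
        (Finset.univ.filter fun y => G.Adj x y ∧ ce x y = c).card := by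
      simp only [← ite_and, Finset.card_filter]
    rw [hsum]
    by_cases hx : cv x = c
    · rw [if_pos hx, Finset.card_eq_zero.2]
      refine Finset.filter_eq_empty_iff.2 fun y _ h => ?_
      exact inc x y h.1 (hx.trans h.2.symm)
    · rw [if_neg hx, zero_add, Finset.card_le_one]
      intro y hy z hz
      simp only [Finset.mem_filter, Finset.mem_univ, true_and] at hy hz
      by_contra hyz
      exact edge x y z hy.1 hz.1 hyz (hy.2.trans hz.2.symm)
  refine ⟨cv, ce, ?_, ?_, ?_⟩
  · intro x y
    by_cases h : G.Adj x y
    · simp only [ce, dif_pos h, dif_pos h.symm, Sym2.eq_swap]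
    · simp only [ce, dif_neg h, dif_neg fun h' => h (G.adj_symm h')]
  · intro x y h
    exact q.injective.ne (C.valid (v := Sum.inl x) (w := Sum.inl y) h)
  · intro x
    -- A vertex and its three edges are four elements for four colours. Each colour occurs at most
    -- once there, hence exactly once.
    have htotal : ∑ c, ((if cv x = c then 1 else 0) +
        ∑ y, (if G.Adj x y then (if ce x y = c then 1 else 0) else 0)) = ∑ c : Color, 1 := by
      rw [Finset.sum_add_distrib, Finset.sum_comm, Finset.sum_ite_eq, if_pos (Finset.mem_univ _)]
      have : ∀ y, ∑ c, (if G.Adj x y then (if ce x y = c then 1 else 0) else 0) =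
          if G.Adj x y then 1 else 0 := by
        intro y
        by_cases h : G.Adj x y <;> simp [h]
      rw [Finset.sum_congr rfl fun y _ => this y, ← Finset.card_filter,
        ← SimpleGraph.neighborFinset_eq_filter, SimpleGraph.card_neighborFinset_eq_degree, hG]
      rfl
    intro c
    exact (Finset.sum_eq_sum_iff_of_le fun c _ => le_one x c).1 htotal c (Finset.mem_univ c)

/-! ### Pieces with three dangling edges -/

/-- The colours of an edge and of one of its ends. -/
abbrev Port : Type := Color × Color

/-- The piece of a Halin graph that consists of the tree `t`, the path through its leaves, and three
dangling edges at the root, the first leaf and the last leaf, has a total colouring in which the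
dangling edges and their ends have the given colours. -/
def Real : BinTree → Port → Port → Port → Prop
  -- The only vertex is root, first leaf and last leaf at once, so the three ports share the colour
  -- of their end.
  | leaf, p, f, g => p.2 = f.2 ∧ p.2 = g.2 ∧ p.2 ≠ p.1 ∧ p.2 ≠ f.1 ∧ p.2 ≠ g.1 ∧
      p.1 ≠ f.1 ∧ p.1 ≠ g.1 ∧ f.1 ≠ g.1
  -- Here `a` and `b` are the ports at the roots of the subtrees, and `h` and `k` are the two ports
  -- of the edge that joins the last leaf of `l` to the first leaf of `r`.
  | node l r, p, f, g => ∃ a b h k : Port, Real l a f h ∧ Real r b k g ∧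
      h.1 = k.1 ∧ h.2 ≠ k.2 ∧ p.2 ≠ a.2 ∧ p.2 ≠ b.2 ∧
      p.2 ≠ a.1 ∧ p.2 ≠ b.1 ∧ p.2 ≠ p.1 ∧ a.1 ≠ b.1 ∧ a.1 ≠ p.1 ∧ b.1 ≠ p.1

/-- A total colouring of a piece of a Halin graph. -/
structure IsPiecePainting (t : BinTree) (p f g : Port) (cv : Pos t → Color)
    (ce : Pos t → Pos t → Color) : Prop where
  symm : ∀ x y, ce x y = ce y x
  adj : ∀ x y, Adj t x y → cv x ≠ cv y
  vroot : cv (root t) = p.2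
  vfirst : cv (first t) = f.2
  vlast : cv (last t) = g.2
  count : ∀ x c, (if cv x = c then 1 else 0) +
    ∑ y, (if Adj t x y then (if ce x y = c then 1 else 0) else 0) +
    (if x = root t then (if p.1 = c then 1 else 0) else 0) +
    (if x = first t then (if f.1 = c then 1 else 0) else 0) +
    (if x = last t then (if g.1 = c then 1 else 0) else 0) = 1

/-- Translates the local condition at a cubic vertex between the counting form, which is additive
under gluing, and pairwise distinctness. -/
theorem forall_count_eq_one_iff (x y z w : Color) :
    (∀ c, (if x = c then 1 else 0) + (if y = c then 1 else 0) + (if z = c then 1 else 0) +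
      (if w = c then 1 else 0) = 1) ↔
    x ≠ y ∧ x ≠ z ∧ x ≠ w ∧ y ≠ z ∧ y ≠ w ∧ z ≠ w := by
  revert x y z w
  decide +kernel

theorem ite_eq_apply {α : Type*} [DecidableEq α] (x a : α) (w : α → ℕ) :
    (if x = a then w x else 0) = if x = a then w a else 0 := by
  by_cases h : x = a
  · rw [h]
  · rw [if_neg h, if_neg h]

theorem exists_isPiecePainting (t : BinTree) (p f g : Port) (h : Real t p f g) :
    ∃ cv ce, IsPiecePainting t p f g cv ce := by
  induction t generalizing p f g with
  | leaf =>
    obtain ⟨h1, h2, h3⟩ := h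
    refine ⟨fun _ => p.2, fun _ _ => Color.c0, fun _ _ => rfl, fun _ _ h => h.elim, rfl, h1, h2, ?_⟩
    intro x c
    exact (forall_count_eq_one_iff p.2 p.1 f.1 g.1).2 h3 c
  | node l r ihl ihr =>
    obtain ⟨a, b, h, k, hl, hr, h1, h2, h3, h4, hc⟩ := h
    obtain ⟨cvl, cel, pl⟩ := ihl _ _ _ hl
    obtain ⟨cvr, cer, pr⟩ := ihr _ _ _ hr
    let cv : Pos (node l r) → Color
      | none => p.2
      | some (Sum.inl x) => cvl x
      | some (Sum.inr x) => cvr x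
    let ce : Pos (node l r) → Pos (node l r) → Color
      | none, none => Color.c0
      | none, some (Sum.inl _) => a.1
      | none, some (Sum.inr _) => b.1
      | some (Sum.inl _), none => a.1
      | some (Sum.inr _), none => b.1
      | some (Sum.inl x), some (Sum.inl y) => cel x y
      | some (Sum.inr x), some (Sum.inr y) => cer x y
      | some (Sum.inl _), some (Sum.inr _) => h.1
      | some (Sum.inr _), some (Sum.inl _) => h.1
    refine ⟨cv, ce, ?_, ?_, rfl, pl.vfirst, pr.vlast, ?_⟩
    · intro x y
      match x, y with
      | none, none => rfl
      | none, some (Sum.inl _) => rfl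
      | none, some (Sum.inr _) => rfl
      | some (Sum.inl _), none => rfl
      | some (Sum.inr _), none => rfl
      | some (Sum.inl x), some (Sum.inl y) => exact pl.symm x y
      | some (Sum.inr x), some (Sum.inr y) => exact pr.symm x y
      | some (Sum.inl _), some (Sum.inr _) => rfl
      | some (Sum.inr _), some (Sum.inl _) => rfl
    · intro x y hxy
      have h3' : p.2 ≠ cvl (root l) := pl.vroot ▸ h3
      have h4' : p.2 ≠ cvr (root r) := pr.vroot ▸ h4
      have h2' : cvl (last l) ≠ cvr (first r) := by rwa [pl.vlast, pr.vfirst]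
      match x, y, hxy with
      | none, some (Sum.inl _), rfl => exact h3'
      | none, some (Sum.inr _), rfl => exact h4'
      | some (Sum.inl _), none, rfl => exact h3'.symm
      | some (Sum.inr _), none, rfl => exact h4'.symm
      | some (Sum.inl x), some (Sum.inl y), hxy => exact pl.adj x y hxy
      | some (Sum.inr x), some (Sum.inr y), hxy => exact pr.adj x y hxy
      | some (Sum.inl _), some (Sum.inr _), ⟨rfl, rfl⟩ => exact h2'
      | some (Sum.inr _), some (Sum.inl _), ⟨rfl, rfl⟩ => exact h2'.symm
    · intro x c
      induction x using pos_node_cases with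
      | h =>
        rw [sum_adj_root fun y => if ce (root _) y = c then 1 else 0, if_pos rfl,
          if_neg node_root_ne_first, if_neg node_root_ne_last]
        refine Eq.trans ?_ ((forall_count_eq_one_iff p.2 a.1 b.1 p.1).2 hc c)
        change (if p.2 = c then 1 else 0) + ((if a.1 = c then 1 else 0) +
          (if b.1 = c then 1 else 0)) + _ + 0 + 0 = _
        omega
      | hl x =>
        rw [sum_adj_inl fun y => if ce (inl x) y = c then 1 else 0,
          if_neg (node_inl_ne_root x), if_neg (node_inl_ne_last x),
          if_congr (node_inl_eq_first x) rfl rfl]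
        refine Eq.trans ?_ (pl.count x c)
        change (if cvl x = c then 1 else 0) +
          ((if x = root l then (if a.1 = c then 1 else 0) else 0)
          + ∑ y, (if Adj l x y then (if cel x y = c then 1 else 0) else 0) +
          (if x = last l then (if h.1 = c then 1 else 0) else 0)) + 0 + _ + 0 = _
        omega
      | hr x =>
        rw [sum_adj_inr fun y => if ce (inr x) y = c then 1 else 0,
          if_neg (node_inr_ne_root x), if_neg (node_inr_ne_first x),
          if_congr (node_inr_eq_last x) rfl rfl]
        refine Eq.trans ?_ (pr.count x c)
        change (if cvr x = c then 1 else 0) +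
          ((if x = root r then (if b.1 = c then 1 else 0) else 0)
          + ∑ y, (if Adj r x y then (if cer x y = c then 1 else 0) else 0) +
          (if x = first r then (if h.1 = c then 1 else 0) else 0)) + 0 + 0 + _ = _
        rw [h1]
        omega

/-- Cutting a piece at its root restricts the colouring to both subtrees; the colours of the cut
edges and of their ends are the ports. -/
theorem IsPiecePainting.real (t : BinTree) (p f g : Port) (cv : Pos t → Color)
    (ce : Pos t → Pos t → Color) (h : IsPiecePainting t p f g cv ce) : Real t p f g := by
  induction t generalizing p f g with
  | leaf =>
    refine ⟨h.vroot.symm.trans h.vfirst, h.vroot.symm.trans h.vlast, ?_⟩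
    refine (forall_count_eq_one_iff _ _ _ _).1 fun c => ?_
    exact h.vroot ▸ h.count () c
  | node l r ihl ihr =>
    refine ⟨(ce (root _) (inl (root l)), cv (inl (root l))),
      (ce (root _) (inr (root r)), cv (inr (root r))),
      (ce (inl (last l)) (inr (first r)), cv (inl (last l))),
      (ce (inl (last l)) (inr (first r)), cv (inr (first r))),
      ihl _ _ _ (fun x => cv (inl x)) (fun x y => ce (inl x) (inl y)) ⟨?_, ?_, ?_, ?_, ?_, ?_⟩,
      ihr _ _ _ (fun x => cv (inr x)) (fun x y => ce (inr x) (inr y)) ⟨?_, ?_, ?_, ?_, ?_, ?_⟩,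
      rfl, ?_, ?_, ?_, ?_⟩
    · exact fun x y => h.symm _ _
    · exact fun x y hxy => h.adj (inl x) (inl y) hxy
    · rfl
    · exact h.vfirst
    · rfl
    · intro x c
      have := h.count (inl x) c
      rw [sum_adj_inl fun y => if ce (inl x) y = c then 1 else 0,
        if_neg (node_inl_ne_root x), if_neg (node_inl_ne_last x),
        if_congr (node_inl_eq_first x) rfl rfl] at this
      refine Eq.trans ?_ this
      have e1 := ite_eq_apply x (root l) fun x => if ce (inl x) (root (node l r)) = c then 1 else 0
      have e2 := ite_eq_apply x (last l) fun x => if ce (inl x) (inr (first r)) = c then 1 else 0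
      simp only [h.symm (inl (root l))] at e1
      dsimp only at e1 e2 ⊢
      omega
    · exact fun x y => h.symm _ _
    · exact fun x y hxy => h.adj (inr x) (inr y) hxy
    · rfl
    · rfl
    · exact h.vlast
    · intro x c
      have := h.count (inr x) c
      rw [sum_adj_inr fun y => if ce (inr x) y = c then 1 else 0,
        if_neg (node_inr_ne_root x), if_neg (node_inr_ne_first x),
        if_congr (node_inr_eq_last x) rfl rfl] at this
      refine Eq.trans ?_ this
      have e1 := ite_eq_apply x (root r) fun x => if ce (inr x) (root (node l r)) = c then 1 else 0
      have e2 := ite_eq_apply x (first r) fun x => if ce (inr x) (inl (last l)) = c then 1 else 0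
      simp only [h.symm (inr (root r))] at e1
      simp only [h.symm (inr (first r))] at e2
      dsimp only at e1 e2 ⊢
      omega
    · exact h.adj (inl (last l)) (inr (first r)) ⟨rfl, rfl⟩
    · exact h.vroot ▸ h.adj (root _) (inl (root l)) rfl
    · exact h.vroot ▸ h.adj (root _) (inr (root r)) rfl
    · refine (forall_count_eq_one_iff _ _ _ _).1 fun c => ?_
      have := h.count (root _) c
      rw [sum_adj_root fun y => if ce (root _) y = c then 1 else 0, if_pos rfl,
        if_neg node_root_ne_first, if_neg node_root_ne_last, h.vroot] at this
      refine Eq.trans ?_ this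
      dsimp only
      omega

/-- A single vertex with three dangling edges can be glued to a piece with the given colours on its
dangling edges. -/
def Closes (p f g : Port) : Prop :=
  ∃ c : Color, c ≠ p.2 ∧ c ≠ f.2 ∧ c ≠ g.2 ∧
    c ≠ p.1 ∧ c ≠ f.1 ∧ c ≠ g.1 ∧ p.1 ≠ f.1 ∧ p.1 ≠ g.1 ∧ f.1 ≠ g.1

instance (p f g : Port) : Decidable (Closes p f g) := by
  unfold Closes
  infer_instance

theorem sum_halin_none (l r : BinTree) (w : Option (Pos (node l r)) → ℕ) :
    ∑ y, (if (halin (node l r)).Adj none y then w y else 0) =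
      w (some (root _)) + w (some (first _)) + w (some (last _)) := by
  rw [Fintype.sum_option]
  change (if False then _ else 0) + ∑ y, (if y = _ ∨ y = _ ∨ y = _ then w (some y) else 0) = _
  rw [if_neg id, zero_add, ← Finset.sum_filter]
  have : (Finset.univ.filter fun y : Pos (node l r) => y = root _ ∨ y = first _ ∨ y = last _) =
      {root _, first _, last _} := by
    ext
    simp
  rw [this, Finset.sum_insert, Finset.sum_pair node_first_ne_last, add_assoc]
  simp [node_root_ne_first, node_root_ne_last]

theorem sum_halin_some (l r : BinTree) (w : Option (Pos (node l r)) → ℕ) (x : Pos (node l r)) :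
    ∑ y, (if (halin (node l r)).Adj (some x) y then w y else 0) =
      ∑ y, (if Adj (node l r) x y then w (some y) else 0) +
        (if x = root _ then w none else 0) + (if x = first _ then w none else 0) +
        (if x = last _ then w none else 0) := by
  have h1 := node_root_ne_first (l := l) (r := r)
  have h2 := node_root_ne_last (l := l) (r := r)
  have h3 := node_first_ne_last (l := l) (r := r)
  rw [Fintype.sum_option, add_comm, add_assoc, add_assoc]
  refine congrArg₂ _ rfl ?_
  change (if x = _ ∨ x = _ ∨ x = _ then _ else 0) = _
  by_cases h : x = root (node l r)
  · subst h
    simp [h1, h2]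
  by_cases h' : x = first (node l r)
  · subst h'
    simp [h, h3]
  simp [h, h']

/-- A Halin graph is totally 4-colourable if and only if its piece without one leaf has a total
colouring that fits to that leaf. -/
theorem halin_colorable_iff {t : BinTree} (ht : t ≠ leaf) :
    (totalGraph (halin t)).Colorable 4 ↔ ∃ p f g, Real t p f g ∧ Closes p f g := by
  have hreg := halin_isRegularOfDegree ht
  obtain _ | ⟨l, r⟩ := t
  · exact absurd rfl ht
  have h1 := node_root_ne_first (l := l) (r := r)
  have h2 := node_root_ne_last (l := l) (r := r)
  have h3 := node_first_ne_last (l := l) (r := r)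
  constructor
  · intro h
    obtain ⟨cv, ce, h⟩ := exists_isPainting hreg h
    refine ⟨(ce none (some (root _)), cv (some (root _))),
      (ce none (some (first _)), cv (some (first _))),
      (ce none (some (last _)), cv (some (last _))),
      IsPiecePainting.real _ _ _ _ (fun x => cv (some x)) (fun x y => ce (some x) (some y))
        ⟨?_, ?_, rfl, rfl, rfl, ?_⟩, cv none, ?_, ?_, ?_, ?_⟩
    · exact fun x y => h.symm _ _
    · exact fun x y hxy => h.adj (some x) (some y) hxy
    · intro x c
      have := h.count (some x) c
      rw [sum_halin_some l r (fun y => if ce (some x) y = c then 1 else 0)] at this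
      refine Eq.trans ?_ this
      have e1 := ite_eq_apply x (root _) fun x => if ce (some x) none = c then 1 else 0
      have e2 := ite_eq_apply x (first _) fun x => if ce (some x) none = c then 1 else 0
      have e3 := ite_eq_apply x (last _) fun x => if ce (some x) none = c then 1 else 0
      simp only [h.symm (some _) none] at e1 e2 e3 ⊢
      omega
    · exact h.adj none (some (root _)) (Or.inl rfl)
    · exact h.adj none (some (first _)) (Or.inr (Or.inl rfl))
    · exact h.adj none (some (last _)) (Or.inr (Or.inr rfl))
    · refine (forall_count_eq_one_iff _ _ _ _).1 fun c => ?_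
      have := h.count none c
      rw [sum_halin_none l r (fun y => if ce none y = c then 1 else 0)] at this
      refine Eq.trans ?_ this
      dsimp only
      omega
  · rintro ⟨p, f, g, hreal, c₀, hp, hf, hg, hc⟩
    obtain ⟨cv, ce, h⟩ := exists_isPiecePainting _ _ _ _ hreal
    -- The colour of the edge from the root leaf to `x`. It matters only at the root, the first leaf
    -- and the last leaf, which are distinct in a node.
    let port (x : Pos (node l r)) : Color :=
      if x = root _ then p.1 else if x = first _ then f.1 else g.1
    have portRoot : port (root _) = p.1 := if_pos rfl
    have portFirst : port (first _) = f.1 := (if_neg h1.symm).trans (if_pos rfl)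
    have portLast : port (last _) = g.1 := (if_neg h2.symm).trans (if_neg h3.symm)
    refine IsPainting.colorable (cv := fun x => x.elim c₀ cv)
      (ce := fun x y => x.elim (y.elim c₀ port) fun x => y.elim (port x) (ce x)) ⟨?_, ?_, ?_⟩
    · rintro (_ | x) (_ | y)
      · rfl
      · rfl
      · rfl
      · exact h.symm x y
    · rintro (_ | x) (_ | y) hxy
      · exact hxy.elim
      · obtain rfl | rfl | rfl := hxy
        · exact hp.trans_eq h.vroot.symm
        · exact hf.trans_eq h.vfirst.symm
        · exact hg.trans_eq h.vlast.symm
      · obtain rfl | rfl | rfl := hxy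
        · exact h.vroot.trans_ne hp.symm
        · exact h.vfirst.trans_ne hf.symm
        · exact h.vlast.trans_ne hg.symm
      · exact h.adj x y hxy
    · rintro (_ | x) c
      · rw [sum_halin_none l r]
        refine Eq.trans ?_ ((forall_count_eq_one_iff _ _ _ _).2 hc c)
        change (if c₀ = c then 1 else 0) + ((if port (root _) = c then 1 else 0) +
          (if port (first _) = c then 1 else 0) + (if port (last _) = c then 1 else 0)) = _
        rw [portRoot, portFirst, portLast]
        omega
      · rw [sum_halin_some l r]
        refine Eq.trans ?_ (h.count x c)
        change (if cv x = c then 1 else 0) +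
          (∑ y, (if Adj _ x y then (if ce x y = c then 1 else 0) else 0) +
          (if x = root _ then (if port x = c then 1 else 0) else 0) +
          (if x = first _ then (if port x = c then 1 else 0) else 0) +
          (if x = last _ then (if port x = c then 1 else 0) else 0)) = _
        have e1 := ite_eq_apply x (root _) fun x => if port x = c then 1 else 0
        have e2 := ite_eq_apply x (first _) fun x => if port x = c then 1 else 0
        have e3 := ite_eq_apply x (last _) fun x => if port x = c then 1 else 0
        simp only [portRoot] at e1
        simp only [portFirst] at e2
        simp only [portLast] at e3
        omega

/-! ### Fixing the port at the root by permuting the colours -/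

/-- Recolouring a port. -/
def mapPort (π : Color → Color) (p : Port) : Port :=
  (π p.1, π p.2)

theorem Real.map {π : Color → Color} (hπ : Function.Injective π) (t : BinTree) (p f g : Port)
    (h : Real t p f g) : Real t (mapPort π p) (mapPort π f) (mapPort π g) := by
  induction t generalizing p f g with
  | leaf =>
    obtain ⟨h1, h2, h3, h4, h5, h6, h7, h8⟩ := h
    exact ⟨congrArg π h1, congrArg π h2, hπ.ne h3, hπ.ne h4, hπ.ne h5, hπ.ne h6, hπ.ne h7,
      hπ.ne h8⟩
  | node l r ihl ihr =>
    obtain ⟨a, b, h, k, hl, hr, h1, h2, h3, h4, h5, h6, h7, h8, h9, h10⟩ := h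
    exact ⟨_, _, _, _, ihl _ _ _ hl, ihr _ _ _ hr, congrArg π h1, hπ.ne h2, hπ.ne h3, hπ.ne h4,
      hπ.ne h5, hπ.ne h6, hπ.ne h7, hπ.ne h8, hπ.ne h9, hπ.ne h10⟩

theorem real_map_iff {π : Color → Color} (hπ : Function.Injective π) (t : BinTree)
    (p f g : Port) : Real t (mapPort π p) (mapPort π f) (mapPort π g) ↔ Real t p f g := by
  refine ⟨fun h => ?_, Real.map hπ t p f g⟩
  let e : Color ≃ Color := Equiv.ofBijective π (Finite.injective_iff_bijective.1 hπ)
  have he (q : Port) : mapPort e.symm (mapPort π q) = q :=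
    Prod.ext (e.symm_apply_apply q.1) (e.symm_apply_apply q.2)
  have := h.map e.symm.injective
  rwa [he, he, he] at this

theorem Real.ne (t : BinTree) (p f g : Port) (h : Real t p f g) :
    p.1 ≠ p.2 ∧ f.1 ≠ f.2 ∧ g.1 ≠ g.2 := by
  induction t generalizing p f g with
  | leaf =>
    obtain ⟨h1, h2, h3, h4, h5, -⟩ := h
    exact ⟨h3.symm, h1 ▸ h4.symm, h2 ▸ h5.symm⟩
  | node l r ihl ihr =>
    obtain ⟨a, b, h, k, hl, hr, -, -, -, -, -, -, h7, -⟩ := h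
    exact ⟨h7.symm, (ihl _ _ _ hl).2.1, (ihr _ _ _ hr).2.2⟩

/-- One of the two colours that the first edges of a piece can have at the root if the dangling edge
at the root has colour `c0` and the root has colour `c1`. -/
def edgeColor : Bool → Color
  | false => Color.c2
  | true => Color.c3

/-- Recolouring that maps the colour `edgeColor s` to `c0`, and `c0` or, respectively, the other
edge colour to `c1`. -/
def recolor : Bool → Bool → Color → Color
  | false, false => fun | .c0 => .c1 | .c1 => .c2 | .c2 => .c0 | .c3 => .c3
  | false, true => fun | .c0 => .c2 | .c1 => .c3 | .c2 => .c0 | .c3 => .c1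
  | true, false => fun | .c0 => .c1 | .c1 => .c2 | .c2 => .c3 | .c3 => .c0
  | true, true => fun | .c0 => .c2 | .c1 => .c3 | .c2 => .c1 | .c3 => .c0

theorem recolor_injective (s b : Bool) : Function.Injective (recolor s b) := by
  revert s b
  decide

/-- The root of the subtree must avoid both `c1` and the colour `edgeColor s` of the edge above it.
Two colours remain, `c0` and the other edge colour, and `b` tells which; `recolor s b` brings either
case back to the port `(c0, c1)`. -/
theorem real_edgeColor_iff (t : BinTree) (s : Bool) (f g : Port) :
    (∃ v, v ≠ Color.c1 ∧ Real t (edgeColor s, v) f g) ↔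
      ∃ b, Real t (Color.c0, Color.c1) (mapPort (recolor s b) f) (mapPort (recolor s b) g) := by
  have key (s b : Bool) : Real t (Color.c0, Color.c1) (mapPort (recolor s b) f)
      (mapPort (recolor s b) g) ↔
        Real t (edgeColor s, bif b then edgeColor (!s) else Color.c0) f g := by
    rw [← real_map_iff (recolor_injective s b) t (edgeColor s, _)]
    cases s <;> cases b <;> rfl
  simp only [key]
  constructor
  · rintro ⟨v, hv, h⟩
    have hne := (h.ne).1
    cases s <;> cases v <;> simp [edgeColor] at hv hne
    · exact ⟨false, h⟩
    · exact ⟨true, h⟩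
    · exact ⟨false, h⟩
    · exact ⟨true, h⟩
  · rintro ⟨b, h⟩
    refine ⟨_, ?_, h⟩
    clear h
    revert s b
    decide

/-- Below a root with port `(c0, c1)` the two further edges have the colours `c2` and `c3`, and `s`
gives their order. The joining edge has one colour, so the right port adds only the colour `v` of
its end. -/
theorem real_node_iff (l r : BinTree) (f g : Port) :
    Real (node l r) (Color.c0, Color.c1) f g ↔
      ∃ (s : Bool) (h : Port) (v : Color), v ≠ h.2 ∧
        (∃ u, u ≠ Color.c1 ∧ Real l (edgeColor s, u) f h) ∧
        (∃ u, u ≠ Color.c1 ∧ Real r (edgeColor (!s), u) (h.1, v) g) := by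
  constructor
  · rintro ⟨⟨a, a'⟩, ⟨b, b'⟩, ⟨h, h'⟩, ⟨k, k'⟩, hl, hr, hc⟩
    dsimp only at hc hl hr
    obtain ⟨rfl, h2, h3, h4, h5, h6, -, h8, h9, h10⟩ := hc
    have : ∃ s, a = edgeColor s ∧ b = edgeColor (!s) := by
      clear hl hr h2 h3 h4
      revert a b
      decide
    obtain ⟨s, rfl, rfl⟩ := this
    exact ⟨s, (h, h'), k', h2.symm, ⟨a', h3.symm, hl⟩, ⟨b', h4.symm, hr⟩⟩
  · rintro ⟨s, h, v, hv, ⟨a, ha, hl⟩, ⟨b, hb, hr⟩⟩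
    refine ⟨_, _, _, _, hl, hr, rfl, hv.symm, ha.symm, hb.symm, ?_⟩
    clear hl hr ha hb
    cases s <;> simp [edgeColor]

/-! ### Sets of pairs of ports as bit masks -/

/-- A number for a colour. -/
def Color.code : Color → ℕ
  | c0 => 0
  | c1 => 1
  | c2 => 2
  | c3 => 3

/-- A number for a port. It is less than 12 if the colours of the port are distinct. -/
def portCode (p : Port) : ℕ :=
  -- Modulo 4 the summand 3 is -1: the differences 1, 2, 3 of distinct colours give 0, 1, 2, and
  -- equal colours give 3.
  4 * ((p.2.code + 3 - p.1.code) % 4) + p.1.code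

/-- A number for a pair of ports. -/
def code (f g : Port) : ℕ :=
  16 * portCode f + portCode g

/-- The ports whose two colours are distinct. -/
def ports : List Port :=
  [(.c0, .c1), (.c0, .c2), (.c0, .c3), (.c1, .c0), (.c1, .c2), (.c1, .c3),
    (.c2, .c0), (.c2, .c1), (.c2, .c3), (.c3, .c0), (.c3, .c1), (.c3, .c2)]

theorem mem_ports (p : Port) : p ∈ ports ↔ p.1 ≠ p.2 := by
  revert p
  decide

/-- Sets of pairs of ports are given by their bit masks. -/
def Mem (m : ℕ) (f g : Port) : Prop :=
  m.testBit (code f g) = true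

/-- The mask of the pairs with the given first component. -/
def fstMask (f : Port) : ℕ :=
  0xffff <<< (16 * portCode f)

/-- The mask of the pairs with the given second component. -/
def sndMask (g : Port) : ℕ :=
  0x1000100010001000100010001000100010001000100010001000100010001 <<< portCode g

theorem mem_fstMask (f f' g : Port) : Mem (fstMask f') f g ↔ f' = f := by
  have : ∀ f' f g : Port, (fstMask f').testBit (code f g) = decide (f' = f) := by
    decide +kernel
  rw [Mem, this, decide_eq_true_iff]

theorem mem_sndMask (f g g' : Port) : Mem (sndMask g') f g ↔ g' = g := by
  have : ∀ g' f g : Port, (sndMask g').testBit (code f g) = decide (g' = g) := by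
    decide +kernel
  rw [Mem, this, decide_eq_true_iff]

theorem mem_land (m n : ℕ) (f g : Port) : Mem (m &&& n) f g ↔ Mem m f g ∧ Mem n f g := by
  rw [Mem, Nat.testBit_and, Bool.and_eq_true]
  rfl

/-- The union of a list of masks. -/
def unionMask : List ℕ → ℕ
  | [] => 0
  | m :: l => Nat.lor m (unionMask l)

theorem testBit_unionMask (l : List ℕ) (i : ℕ) :
    (unionMask l).testBit i = true ↔ ∃ m ∈ l, m.testBit i = true := by
  induction l with
  | nil => simp [unionMask]
  | cons m l ih =>
    change (m ||| unionMask l).testBit i = true ↔ _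
    simp [ih]

/-- The union of the second components of those pairs of masks whose first components meet a given
mask. -/
noncomputable def gather (m : ℕ) (l : List (ℕ × ℕ)) : ℕ :=
  List.rec 0 (fun e _ n => bif (Nat.land m e.1).beq 0 then n else Nat.lor e.2 n) l

theorem gather_cons (m : ℕ) (e : ℕ × ℕ) (l : List (ℕ × ℕ)) : gather m (e :: l) =
    bif (Nat.land m e.1).beq 0 then gather m l else Nat.lor e.2 (gather m l) :=
  rfl

theorem testBit_gather (m : ℕ) (l : List (ℕ × ℕ)) (i : ℕ) :
    (gather m l).testBit i = true ↔ ∃ e ∈ l, (∃ k, m.testBit k = true ∧ e.1.testBit k = true) ∧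
      e.2.testBit i = true := by
  induction l with
  | nil => simp [gather]
  | cons e l ih =>
    have hmeet : (Nat.land m e.1).beq 0 = false ↔
        ∃ k, m.testBit k = true ∧ e.1.testBit k = true := by
      rw [← Bool.not_eq_true, Nat.beq_eq, ← not_iff_not, not_not]
      change m &&& e.1 = 0 ↔ _
      refine ⟨fun h => ?_, fun h => Nat.eq_of_testBit_eq fun k => ?_⟩
      · rintro ⟨k, hk⟩
        rw [← Bool.and_eq_true, ← Nat.testBit_and, h] at hk
        simp at hk
      · rw [Nat.testBit_and, Nat.zero_testBit, Bool.and_eq_false_iff, ← Bool.not_eq_true,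
          ← Bool.not_eq_true, ← not_and_or]
        exact fun hk => h ⟨k, hk⟩
    simp only [List.mem_cons, exists_eq_or_imp, ← ih, ← hmeet, gather_cons]
    cases (Nat.land m e.1).beq 0
    · change (e.2 ||| gather m l).testBit i = true ↔ _
      simp
    · simp

/-- Whether a piece with the given mask can occur below the root, with the edge to the root coloured
with `edgeColor s`. -/
def Slice (m : ℕ) (s : Bool) (f g : Port) : Prop :=
  ∃ b, Mem m (mapPort (recolor s b) f) (mapPort (recolor s b) g)

/-- The bits that decide about `Slice`. -/
def sliceBits (s : Bool) (f g : Port) : List ℕ :=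
  [2 ^ code (mapPort (recolor s false) f) (mapPort (recolor s false) g),
    2 ^ code (mapPort (recolor s true) f) (mapPort (recolor s true) g)]

/-- Writes membership as the meeting of `m` with a given set of bits, the form that `gather` tests.
-/
theorem slice_iff (m : ℕ) (s : Bool) (f g : Port) :
    Slice m s f g ↔ ∃ k, m.testBit k = true ∧ ∃ t ∈ sliceBits s f g, t.testBit k = true := by
  simp [Slice, sliceBits, Mem, Nat.testBit_two_pow]
  constructor
  · rintro (h | h)
    · exact ⟨_, h, Or.inl rfl⟩
    · exact ⟨_, h, Or.inr rfl⟩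
  · rintro ⟨k, h, rfl | rfl⟩
    · exact Or.inl h
    · exact Or.inr h

theorem code_lt (f g : Port) : code f g < 256 := by
  revert f g
  decide +kernel

theorem fstMask_lt (f : Port) : fstMask f < 2 ^ 256 := by
  revert f
  decide +kernel

theorem sndMask_lt (g : Port) : sndMask g < 2 ^ 256 := by
  revert g
  decide +kernel

/-- The ways in which the two subtrees of a node can be glued together. -/
def joints : List (Bool × Port) :=
  ports.map (Prod.mk false) ++ ports.map (Prod.mk true)

theorem mem_joints (j : Bool × Port) : j ∈ joints ↔ j.2 ∈ ports := by
  revert j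
  decide

/-- A number for a joint. -/
def jointCode (j : Bool × Port) : ℕ :=
  (bif j.1 then 16 else 0) + portCode j.2

theorem jointCode_injective : Function.Injective jointCode := by
  intro j j'
  revert j j'
  decide +kernel

theorem exists_jointCode (k : ℕ) (hk : k < 32) : ∃ j, jointCode j = k := by
  have : ∀ k : Fin 32, ∃ j, jointCode j = k := by
    decide +kernel
  exact this ⟨k, hk⟩

theorem jointCode_lt (j : Bool × Port) : jointCode j < 32 := by
  revert j
  decide

theorem testBit_shiftLeft_block {m : ℕ} (hm : m < 2 ^ 256) (i k c : ℕ) (hc : c < 256) :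
    (m <<< (256 * i)).testBit (256 * k + c) = true ↔ i = k ∧ m.testBit c = true := by
  rw [Nat.testBit_shiftLeft, Bool.and_eq_true, decide_eq_true_iff]
  obtain h | rfl | h := lt_trichotomy i k
  · have : m < 2 ^ (256 * k + c - 256 * i) :=
      hm.trans_le (Nat.pow_le_pow_right (by norm_num) (by omega))
    simp [Nat.testBit_lt_two_pow this, h.ne]
  · simp
  · simp only [h.ne', false_and, iff_false, not_and]
    omega

/-- The pairs that are gathered for a left subtree: for each joint and each port at the first leaf,
the bits that allow it, and the set of all pairs with this first port, in the block of the joint. -/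
def leftEntries : List (ℕ × ℕ) :=
  joints.flatMap fun j => ports.map fun f =>
    (unionMask (sliceBits j.1 f j.2), fstMask f <<< (256 * jointCode j))

/-- The pairs that are gathered for a right subtree: for each joint and each port at the last leaf,
the bits that allow it, and the set of all pairs with this second port, in the block of the
joint. -/
def rightEntries : List (ℕ × ℕ) :=
  joints.flatMap fun j => ports.map fun g =>
    (unionMask ([Color.c0, Color.c1, Color.c2, Color.c3].flatMap fun v =>
      bif v.code.beq j.2.2.code then [] else sliceBits (!j.1) (j.2.1, v) g),
      sndMask g <<< (256 * jointCode j))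

theorem Color.code_beq (v w : Color) : v.code.beq w.code = decide (v = w) := by
  revert v w
  decide

/-- In the block of a joint this is a strip: the admissible ports at the first leaf, times all ports
at the last. The right subtree gives the transposed strip, and the intersection of the two is the
product of the admissible sets. -/
theorem testBit_gather_leftEntries (m : ℕ) (j : Bool × Port) (f g : Port) :
    (gather m leftEntries).testBit (256 * jointCode j + code f g) = true ↔
      j.2 ∈ ports ∧ f ∈ ports ∧ Slice m j.1 f j.2 := by
  have block (i : Bool × Port) (f' : Port) :
      (fstMask f' <<< (256 * jointCode i)).testBit (256 * jointCode j + code f g) = true ↔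
        i = j ∧ f' = f := by
    rw [testBit_shiftLeft_block (fstMask_lt f') _ _ _ (code_lt f g), jointCode_injective.eq_iff]
    exact and_congr_right fun _ => mem_fstMask f f' g
  rw [testBit_gather]
  simp only [leftEntries, List.mem_flatMap, List.mem_map, slice_iff]
  constructor
  · rintro ⟨_, ⟨i, hi, f', hf, rfl⟩, h, h'⟩
    obtain ⟨rfl, rfl⟩ := (block _ _).1 h'
    exact ⟨(mem_joints _).1 hi, hf, by simpa only [testBit_unionMask] using h⟩
  · rintro ⟨hj, hf, h⟩
    exact ⟨_, ⟨j, (mem_joints j).2 hj, f, hf, rfl⟩, by simpa only [testBit_unionMask] using h,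
      (block _ _).2 ⟨rfl, rfl⟩⟩

theorem testBit_gather_rightEntries (m : ℕ) (j : Bool × Port) (f g : Port) :
    (gather m rightEntries).testBit (256 * jointCode j + code f g) = true ↔
      j.2 ∈ ports ∧ g ∈ ports ∧ ∃ v : Color, v ≠ j.2.2 ∧ Slice m (!j.1) (j.2.1, v) g := by
  have block (i : Bool × Port) (g' : Port) :
      (sndMask g' <<< (256 * jointCode i)).testBit (256 * jointCode j + code f g) = true ↔
        i = j ∧ g' = g := by
    rw [testBit_shiftLeft_block (sndMask_lt g') _ _ _ (code_lt f g), jointCode_injective.eq_iff]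
    exact and_congr_right fun _ => mem_sndMask f g g'
  have bits (i : Bool × Port) (g' : Port) :
      (∃ k, m.testBit k = true ∧ (unionMask ([Color.c0, Color.c1, Color.c2, Color.c3].flatMap
        fun v => bif v.code.beq i.2.2.code then [] else
          sliceBits (!i.1) (i.2.1, v) g')).testBit k = true) ↔
      ∃ v : Color, v ≠ i.2.2 ∧ Slice m (!i.1) (i.2.1, v) g' := by
    simp only [testBit_unionMask, List.mem_flatMap, slice_iff, Color.code_beq]
    constructor
    · rintro ⟨k, hk, t, ⟨v, -, ht⟩, htk⟩
      by_cases hv : v = i.2.2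
      · simp [hv] at ht
      · exact ⟨v, hv, k, hk, t, by simpa [hv] using ht, htk⟩
    · rintro ⟨v, hv, k, hk, t, ht, htk⟩
      exact ⟨k, hk, t, ⟨v, by cases v <;> simp, by simpa [hv] using ht⟩, htk⟩
  rw [testBit_gather]
  simp only [rightEntries, List.mem_flatMap, List.mem_map]
  constructor
  · rintro ⟨_, ⟨i, hi, g', hg, rfl⟩, h, h'⟩
    obtain ⟨rfl, rfl⟩ := (block _ _).1 h'
    exact ⟨(mem_joints _).1 hi, hg, (bits _ _).1 h⟩
  · rintro ⟨hj, hg, h⟩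
    exact ⟨_, ⟨j, (mem_joints j).2 hj, g, hg, rfl⟩, (bits _ _).2 h, (block _ _).2 ⟨rfl, rfl⟩⟩

/-- The value `k n`, arranged such that `n` is evaluated first. -/
def withValue {α : Type} (n : ℕ) (k : ℕ → α) : α :=
  match n with
  | 0 => k 0
  | m + 1 => k (m + 1)

theorem withValue_eq {α : Type} (n : ℕ) (k : ℕ → α) : withValue n k = k n := by
  cases n <;> rfl

/-- The union of a mask and its part from a given bit on. -/
def foldAt (i m : ℕ) : ℕ :=
  withValue m fun m => Nat.lor m (Nat.shiftRight m i)

theorem testBit_foldAt (i m k : ℕ) :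
    (foldAt i m).testBit k = (m.testBit k || m.testBit (i + k)) := by
  rw [foldAt, withValue_eq]
  change (m ||| m >>> i).testBit k = _
  rw [Nat.testBit_or, Nat.testBit_shiftRight]

/-- The union of the 32 blocks of the given mask. -/
def foldBlocks (m : ℕ) : ℕ :=
  withValue (foldAt 256 (foldAt 512 (foldAt 1024 (foldAt 2048 (foldAt 4096 m))))) fun n =>
    Nat.mod n 0x10000000000000000000000000000000000000000000000000000000000000000

theorem mem_foldBlocks (m : ℕ) (f g : Port) :
    Mem (foldBlocks m) f g ↔ ∃ j, m.testBit (256 * jointCode j + code f g) = true := by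
  -- One fold halves the number of blocks. Five folds, starting with 16 blocks of 256 bits, unite
  -- all 32 of them in the lowest block; the remainder modulo `2 ^ 256` discards the rest.
  have key (b n c : ℕ) : (∃ k < b, (foldAt (256 * b) n).testBit (256 * k + c) = true) ↔
      ∃ k < 2 * b, n.testBit (256 * k + c) = true := by
    simp only [testBit_foldAt, Bool.or_eq_true]
    constructor
    · rintro ⟨k, hk, h | h⟩
      · exact ⟨k, by omega, h⟩
      · exact ⟨b + k, by omega, by rwa [mul_add, add_assoc]⟩
    · rintro ⟨k, hk, h⟩
      by_cases hkb : k < b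
      · exact ⟨k, hkb, Or.inl h⟩
      · obtain ⟨i, rfl⟩ := Nat.exists_eq_add_of_le (not_lt.1 hkb)
        exact ⟨i, by omega, Or.inr (by rwa [mul_add, add_assoc] at h)⟩
  have hblocks : Mem (foldBlocks m) f g ↔ ∃ k < 32, m.testBit (256 * k + code f g) = true := by
    rw [← key 16, ← key 8, ← key 4, ← key 2, ← key 1]
    rw [foldBlocks, withValue_eq, Mem]
    change (_ % 2 ^ 256).testBit _ = true ↔ _
    rw [Nat.testBit_mod_two_pow, decide_eq_true (code_lt f g), Bool.true_and]
    simp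
  rw [hblocks]
  constructor
  · rintro ⟨k, hk, h⟩
    obtain ⟨j, rfl⟩ := exists_jointCode k hk
    exact ⟨j, h⟩
  · rintro ⟨j, h⟩
    exact ⟨_, jointCode_lt j, h⟩

/-- The mask of a node with subtrees that have the given masks. -/
noncomputable def nodeMask (m n : ℕ) : ℕ :=
  foldBlocks (Nat.land (gather m leftEntries) (gather n rightEntries))

theorem mem_nodeMask (m n : ℕ) (f g : Port) :
    Mem (nodeMask m n) f g ↔ f ∈ ports ∧ g ∈ ports ∧
      ∃ s : Bool, ∃ h ∈ ports, ∃ v : Color, v ≠ h.2 ∧ Slice m s f h ∧ Slice n (!s) (h.1, v) g := by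
  have hand (j : Bool × Port) : (Nat.land (gather m leftEntries) (gather n rightEntries)).testBit
      (256 * jointCode j + code f g) = true ↔
        (gather m leftEntries).testBit (256 * jointCode j + code f g) = true ∧
        (gather n rightEntries).testBit (256 * jointCode j + code f g) = true := by
    rw [← Bool.and_eq_true, ← Nat.testBit_and]
    rfl
  rw [nodeMask, mem_foldBlocks, exists_congr hand]
  simp only [testBit_gather_leftEntries, testBit_gather_rightEntries]
  constructor
  · rintro ⟨⟨s, h⟩, ⟨hh, hf, hs⟩, -, hg, v, hv, hs'⟩
    exact ⟨hf, hg, s, h, hh, v, hv, hs, hs'⟩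
  · rintro ⟨hf, hg, s, h, hh, v, hv, hs, hs'⟩
    exact ⟨(s, h), ⟨hh, hf, hs⟩, hh, hg, v, hv, hs'⟩

/-! ### The mask of a tree -/

/-- The mask of a tree: the port colours of its piece at the first and the last leaf when the port
at the root has the colours `c0` and `c1`. -/
noncomputable def treeMask : BinTree → ℕ
  | leaf => 0x800000000004000000000000000000000000000000
  | node l r => withValue (treeMask l) fun m => withValue (treeMask r) fun n => nodeMask m n

theorem treeMask_node (l r : BinTree) :
    treeMask (node l r) = nodeMask (treeMask l) (treeMask r) := by
  rw [treeMask, withValue_eq, withValue_eq]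

/-- `mem_nodeMask` and `real_node_iff` are the same recursion; `Real.ne` supplies the distinct
colours that membership in `ports` demands. -/
theorem mem_treeMask (t : BinTree) (f g : Port) :
    Mem (treeMask t) f g ↔ Real t (Color.c0, Color.c1) f g := by
  induction t generalizing f g with
  | leaf =>
    revert f g
    unfold Mem Real
    decide +kernel
  | node l r ihl ihr =>
    rw [treeMask_node, mem_nodeMask, real_node_iff]
    simp only [Slice, ihl, ihr, ← real_edgeColor_iff]
    constructor
    · rintro ⟨-, -, s, h, -, v, hv, hl, hr⟩
      exact ⟨s, h, v, hv, hl, hr⟩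
    · rintro ⟨s, h, v, hv, hl, hr⟩
      obtain ⟨a, -, ha⟩ := id hl
      obtain ⟨b, -, hb⟩ := id hr
      exact ⟨(mem_ports _).2 ha.ne.2.1, (mem_ports _).2 hb.ne.2.2, s, h,
        (mem_ports _).2 ha.ne.2.2, v, hv, hl, hr⟩

/-- Whether a mask contains a pair that fits to a leaf at the root. -/
def closesMask (m : ℕ) : Bool :=
  decide (∃ f ∈ ports, ∃ g ∈ ports, m.testBit (code f g) = true ∧ Closes (.c0, .c1) f g)

theorem halin_colorable_iff_closesMask {t : BinTree} (ht : t ≠ leaf) :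
    (totalGraph (halin t)).Colorable 4 ↔ closesMask (treeMask t) = true := by
  rw [halin_colorable_iff ht, closesMask, decide_eq_true_iff]
  constructor
  · rintro ⟨p, f, g, h, hc⟩
    have hne := h.ne.1
    -- The first swap moves `p.1` to `c0`; the second moves the image of `p.2` to `c1` and fixes
    -- `c0`, since that image is not `c0`.
    let π : Equiv.Perm Color := Equiv.swap (Equiv.swap p.1 .c0 p.2) .c1 * Equiv.swap p.1 .c0
    have hπ : mapPort π p = (.c0, .c1) := by
      have : ∀ a b : Color, a ≠ b → Equiv.swap (Equiv.swap a .c0 b) .c1 (Equiv.swap a .c0 a) = .c0 ∧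
          Equiv.swap (Equiv.swap a .c0 b) .c1 (Equiv.swap a .c0 b) = .c1 := by
        decide
      exact Prod.ext (this _ _ hne).1 (this _ _ hne).2
    have h' := h.map π.injective
    rw [hπ] at h'
    refine ⟨_, (mem_ports _).2 h'.ne.2.1, _, (mem_ports _).2 h'.ne.2.2,
      (mem_treeMask t _ _).2 h', ?_⟩
    obtain ⟨c, h1, h2, h3, h4, h5, h6, h7, h8, h9⟩ := hc
    rw [← hπ]
    exact ⟨π c, π.injective.ne h1, π.injective.ne h2, π.injective.ne h3, π.injective.ne h4,
      π.injective.ne h5, π.injective.ne h6, π.injective.ne h7, π.injective.ne h8,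
      π.injective.ne h9⟩
  · rintro ⟨f, -, g, -, hm, hc⟩
    exact ⟨_, f, g, (mem_treeMask t f g).1 hm, hc⟩

/-! ### Monotonicity and the finite closure check -/

/-- Inclusion of the sets that are given by two masks. -/
def MaskLe (m n : ℕ) : Prop :=
  ∀ f g, Mem m f g → Mem n f g

theorem maskLe_of_land_eq {m n : ℕ} (h : (Nat.land m n).beq m = true) : MaskLe m n := by
  intro f g hm
  rw [← Nat.eq_of_beq_eq_true h] at hm
  exact ((mem_land m n f g).1 hm).2

theorem MaskLe.trans {m n k : ℕ} (h : MaskLe m n) (h' : MaskLe n k) : MaskLe m k :=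
  fun f g hm => h' f g (h f g hm)

theorem MaskLe.slice {m n : ℕ} (h : MaskLe m n) (s : Bool) (f g : Port) (hm : Slice m s f g) :
    Slice n s f g :=
  hm.imp fun _ => h _ _

/-- The masks of the subtrees enter `mem_nodeMask` only positively. This monotonicity allows a tree
to be represented by a lower bound for its mask. -/
theorem MaskLe.nodeMask {m m' n n' : ℕ} (h : MaskLe m m') (h' : MaskLe n n') :
    MaskLe (nodeMask m n) (HalinGraph.nodeMask m' n') := by
  intro f g hm
  rw [mem_nodeMask] at hm ⊢
  obtain ⟨hf, hg, s, k, hk, v, hv, h1, h2⟩ := hm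
  exact ⟨hf, hg, s, k, hk, v, hv, h.slice _ _ _ h1, h'.slice _ _ _ h2⟩

theorem MaskLe.closesMask {m n : ℕ} (h : MaskLe m n) (hm : closesMask m = true) :
    HalinGraph.closesMask n = true := by
  rw [HalinGraph.closesMask, decide_eq_true_iff] at hm ⊢
  obtain ⟨f, hf, g, hg, hm, hc⟩ := hm
  exact ⟨f, hf, g, hg, h f g hm, hc⟩

/-- The plane binary trees that belong to the graphs `K4`, `H4`, `H5` and `H8`, and all their
subtrees, with their masks. -/
def smallTrees : List (BinTree × ℕ) := [
  (.leaf,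
    0x800000000004000000000000000000000000000000),
  ((.node .leaf .leaf),
    0x5000000100000201080010000000200000),
  ((.node .leaf (.node .leaf .leaf)),
    0xdfe000000000044001100000808000001010000),
  ((.node (.node .leaf .leaf) .leaf),
    0x20802000000020202000240020002200208024002000022),
  ((.node .leaf (.node .leaf (.node .leaf .leaf))),
    0x222088800000222000004440000),
  ((.node (.node (.node .leaf .leaf) .leaf) .leaf),
    0x2000020048000000200002004800000020000200480000),
  ((.node .leaf (.node .leaf (.node .leaf (.node .leaf .leaf)))),
    0x99906660000055500000aaa0000),
  ((.node .leaf (.node (.node (.node .leaf .leaf) .leaf) .leaf)),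
    0x401000000810064008104010000080a0000),
  ((.node (.node .leaf .leaf) (.node (.node .leaf .leaf) .leaf)),
    0x9160ddd000009140ddd09bd081009140d57093401040914),
  ((.node (.node .leaf (.node .leaf .leaf)) (.node .leaf .leaf)),
    0xdfd048800000ddf04c0048800440dfd04c00ddf080804c8),
  ((.node (.node .leaf (.node .leaf (.node .leaf .leaf))) .leaf),
    0x201080000000000500020002000000002002000020158),
  ((.node (.node (.node (.node .leaf .leaf) .leaf) .leaf) .leaf),
    0x4200280022004800420028002200480042002800220048),
  ((.node .leaf (.node .leaf (.node .leaf (.node .leaf (.node .leaf .leaf))))),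
    0xddd077700000ddd00000bbb0000),
  ((.node .leaf (.node (.node (.node (.node .leaf .leaf) .leaf) .leaf) .leaf)),
    0x936015400000918043109180154000001830000),
  ((.node (.node .leaf .leaf) (.node .leaf (.node .leaf (.node .leaf .leaf)))),
    0x9990777000005550bbb0555033309990999055503330eee),
  ((.node (.node .leaf .leaf) (.node (.node (.node .leaf .leaf) .leaf) .leaf)),
    0x1b3017400000176091a05310112093a019305330130086e),
  ((.node (.node .leaf (.node .leaf .leaf)) (.node (.node .leaf .leaf) .leaf)),
    0x57508100000099f0104081008120d750104099b01240914),
  ((.node (.node .leaf (.node .leaf (.node .leaf .leaf))) (.node .leaf .leaf)),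
    0x91004400000dfe080805010d570dfe0091050109bd084c),
  ((.node (.node .leaf (.node .leaf (.node .leaf (.node .leaf .leaf)))) .leaf),
    0x25000200000035a00020108022003780050030802020022),
  ((.node (.node (.node (.node .leaf .leaf) .leaf) .leaf) (.node .leaf .leaf)),
    0x899054504a30dfe0899054504a30dfe0899054504a30dfe),
  ((.node (.node (.node (.node (.node .leaf .leaf) .leaf) .leaf) .leaf) .leaf),
    0x4a00680022006a004a00680022006a004a00680022006a),
  ((.node .leaf (.node (.node .leaf .leaf) (.node .leaf (.node .leaf (.node .leaf .leaf))))),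
    0xfff0fff00000eee0ddd0fff0eee00000ddd0000),
  ((.node (.node (.node (.node (.node .leaf .leaf) .leaf) .leaf) (.node .leaf .leaf)) .leaf),
    0x37a037a03580332037a037a03580332037a037a03580332),
  ((.node .leaf (.node .leaf (.node (.node .leaf .leaf) (.node .leaf (.node .leaf (.node .leaf .leaf)))))),
    0xfff000000000bbb0eee0000077700000eee0000),
  ((.node (.node .leaf (.node .leaf (.node .leaf .leaf))) (.node (.node (.node .leaf .leaf) .leaf) .leaf)),
    0x640081000000000401080a080a00000064080a00640481),
  ((.node (.node (.node (.node (.node (.node .leaf .leaf) .leaf) .leaf) (.node .leaf .leaf)) .leaf) .leaf),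
    0x262022a026a02480262022a026a02480262022a026a0248),
  ((.node .leaf (.node .leaf (.node .leaf (.node (.node .leaf .leaf) (.node .leaf (.node .leaf (.node .leaf .leaf))))))),
    0xddd077700000ddd00000bbb0000),
  ((.node .leaf (.node (.node .leaf (.node .leaf (.node .leaf .leaf))) (.node (.node (.node .leaf .leaf) .leaf) .leaf))),
    0x9360d5d000009950e7709dd0d1500000baf0000),
  ((.node .leaf (.node (.node (.node (.node (.node (.node .leaf .leaf) .leaf) .leaf) (.node .leaf .leaf)) .leaf) .leaf)),
    0x9360555000009990575099905550000099b0000),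
  ((.node (.node .leaf .leaf) (.node (.node (.node (.node (.node .leaf .leaf) .leaf) .leaf) (.node .leaf .leaf)) .leaf)),
    0xdff0dfd00000dff0ddf0dfd0d570dff0ddf0dff09bd0dfe),
  ((.node (.node .leaf (.node .leaf .leaf)) (.node (.node (.node (.node .leaf .leaf) .leaf) .leaf) (.node .leaf .leaf))),
    0xfff0dec00000fff0cde0dec02660fff0cde0fff0a2a0dfe),
  ((.node (.node .leaf (.node .leaf (.node (.node .leaf .leaf) (.node .leaf (.node .leaf (.node .leaf .leaf)))))) .leaf),
    0x25201280000037a005201280220037a005203280202017a),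
  ((.node (.node .leaf (.node (.node .leaf .leaf) (.node .leaf (.node .leaf (.node .leaf .leaf))))) (.node .leaf .leaf)),
    0xdff0dfd00000dff0ddf0dfd0d570dff0ddf0dff09bd0dfe),
  ((.node (.node (.node .leaf .leaf) (.node .leaf (.node .leaf (.node .leaf .leaf)))) (.node (.node .leaf .leaf) .leaf)),
    0xddf0ddd09360d550ddd0dfd0d77099d0ddf0dfd09bf0914),
  ((.node (.node (.node .leaf (.node .leaf (.node .leaf .leaf))) (.node (.node (.node .leaf .leaf) .leaf) .leaf)) .leaf),
    0x37a01280022035a00520130022203780112037a0222017a),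
  ((.node (.node (.node (.node (.node (.node (.node .leaf .leaf) .leaf) .leaf) (.node .leaf .leaf)) .leaf) .leaf) .leaf),
    0x4a00680022006a004a00680022006a004a00680022006a)]

/-- A list of masks such that the mask of every plane binary tree that is not in the list
`smallTrees` contains one of them. -/
def lowerMasks : List ℕ := [
  0x8010000012000050012080800120120000000440000,
  0x4200000000000a00000008010800600040002800500000,
  0x401000000830064008104210000080a0000,
  0x20006a00000000006a0000002000000000000200020048,
  0x104080200000c40002408000810008c0004081001040804,
  0x4800000000004810c0200000481000000a40000,
  0x45100020000082100200002000000070020018900000000,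
  0x800a10000008004030004008304000800004004210000,
  0x85000000000010c04020908000000a0000000540000,
  0x203080000000002500020002000000002002000020158,
  0x2000000000000a0000006200080060002a000200400000,
  0x2000180000010401400002081208100020000201240804,
  0x36c045200000a5a000001a80000,
  0x158002400000012010408020120000008100000,
  0x1002200000000a02020108022000600050010002020000,
  0x401c20000000004380802000800000024080000400000,
  0x4a20000004004a20104000200080810000000200804,
  0x222038c0000022200000e500000,
  0x84c00000000014c043100000858000001830000,
  0x310000000000c200000080080a04280400010300640000,
  0x20800200000004200020248002000280248024000020022,
  0x560ad1000009280000070d0000,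
  0x800200048004200020048004200280048004000280022,
  0x480000000000481025100000481000003090000,
  0x28c01000000048000100224000004800a020e4000000110,
  0x20024a0000000002680000000200000000000200200048,
  0x6002420000000a02280020000000600002000a00000000,
  0x408100000080001040480008200040480080004200804,
  0x4202000000002802000200010000420200002800100000,
  0x12e0c0200000872000000a40000,
  0x400000000080200000012090000240120080000140048,
  0x590080000000085088200040c01000004240000,
  0x4a02200000005002020100002001080010006800020000,
  0x80400140000081000a40900010400000c020000,
  0x9900040000000008000280040000000600054100800048,
  0x84c000000000085025100000c01000003090000,
  0x28000200000040002000080060000800400042000a0000,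
  0x20022002480060020200020048000a0020000200480000,
  0x10800050000000008010808004c00000044005008480110,
  0x32800000022020200000040004802200008025200480022,
  0x4a2004400000148043108080058000001830000,
  0xc84003000000910042001020114000000820000,
  0x2401090000000000510080080a00000400080200640d94,
  0x80008004800020040006000400020000a004000080048,
  0x1080000000000000405020016000000b000010920006a,
  0x16409a00000081a000004160000,
  0x88903e40000044500000e1a0000,
  0x8040000000008250c0a00000807000000e40000,
  0x220060000000120434000a0120000009820000,
  0x210000008b042000030461000000820000,
  0x10200480132002000480040000800020008003000400022,
  0x480004100000881042000090405000000820000,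
  0xa00000980018200600414000004300000,
  0x10100000000010200000002080800300020001100440048,
  0x800000207098100400a21000004150000,
  0x6800220000000800220008000200400040004a00200048,
  0x80400440000081001840808010400000c100000,
  0x2480000004202480020000000280002000000000000,
  0x201080048014000500020002000180002002000020000,
  0x14a02020000002802200048000000420048007800000000,
  0x4c8000800000244038900400a08000006510000,
  0x2460e1900000a28000003c50000,
  0x20200480000000000480002002000000020022000020048,
  0x440000208040410002008000840018000040088000c0000,
  0x480400000000b000800008008805020040004804400000]

/-- Equality of trees as a Boolean function that is easy to evaluate. -/
def BinTree.beq : BinTree → BinTree → Bool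
  | leaf, leaf => true
  | node l r, node l' r' => l.beq l' && r.beq r'
  | _, _ => false

theorem BinTree.eq_of_beq (t u : BinTree) (h : t.beq u = true) : t = u := by
  induction t generalizing u with
  | leaf => cases u <;> simp_all [BinTree.beq]
  | node l r ihl ihr =>
    cases u with
    | leaf => simp [BinTree.beq] at h
    | node l' r' =>
      rw [BinTree.beq, Bool.and_eq_true] at h
      rw [ihl _ h.1, ihr _ h.2]

/-- The value `k l`, arranged such that the entries of `l` are evaluated first. -/
def withEntries : List (ℕ × ℕ) → (List (ℕ × ℕ) → Bool) → Bool
  | [], k => k []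
  | (m, n) :: l, k =>
    withValue m fun m => withValue n fun n => withEntries l fun l => k ((m, n) :: l)

theorem withEntries_eq (l : List (ℕ × ℕ)) (k : List (ℕ × ℕ) → Bool) : withEntries l k = k l := by
  induction l generalizing k with
  | nil => rfl
  | cons e l ih => rw [withEntries, withValue_eq, withValue_eq, ih]

/-- The value of `k` at the list of all pairs `(a, w a)` for `a` in `l`, arranged such that the
numbers `w a` are evaluated first. -/
def withMasks {α : Type} (w : α → ℕ) : List α → (List (α × ℕ) → Bool) → Bool
  | [], k => k []
  | a :: l, k => withValue (w a) fun m => withMasks w l fun ms => k ((a, m) :: ms)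

theorem withMasks_eq {α : Type} (w : α → ℕ) (l : List α) (k : List (α × ℕ) → Bool) :
    withMasks w l k = k (l.map fun a => (a, w a)) := by
  induction l generalizing k with
  | nil => rfl
  | cons n l ih => rw [withMasks, withValue_eq, ih, List.map_cons]

/-- Whether a mask contains one of the masks in a list. -/
noncomputable def hasLower (ms : List ℕ) (n : ℕ) : Bool :=
  List.rec false (fun m _ b => bif (Nat.land m n).beq m then true else b) ms

/-- Whether all elements of a list satisfy a condition. -/
noncomputable def allTrue {α : Type} (q : α → Bool) (l : List α) : Bool :=
  List.rec true (fun a _ b => bif q a then b else false) l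

theorem allTrue_eq {α : Type} (q : α → Bool) (l : List α) : allTrue q l = l.all q := by
  induction l with
  | nil => rfl
  | cons a l ih =>
    rw [List.all_cons, ← ih]
    change (bif q a then allTrue q l else false) = _
    cases q a <;> rfl

/-- Whether all nodes with subtrees from two lists satisfy a condition. The functions `f` and `g`
are the masks of the subtrees. -/
noncomputable def forallNodes {α β : Type} (f : α → ℕ) (g : β → ℕ) (q : α → β → ℕ → Bool)
    (l : List α) (k : List β) : Bool :=
  -- Gathering depends on one subtree only. It is done once for each member of a list, so that a
  -- pair costs only an intersection and a folding.
  withEntries leftEntries fun es => withEntries rightEntries fun es' =>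
    withMasks (fun a => gather (f a) es) l fun us =>
      withMasks (fun b => gather (g b) es') k fun ws =>
        allTrue (fun u => allTrue (fun w => withValue (foldBlocks (Nat.land u.2 w.2))
          (q u.1 w.1)) ws) us

theorem forallNodes_iff {α β : Type} (f : α → ℕ) (g : β → ℕ) (q : α → β → ℕ → Bool) (l : List α)
    (k : List β) :
    forallNodes f g q l k = true ↔ ∀ a ∈ l, ∀ b ∈ k, q a b (nodeMask (f a) (g b)) = true := by
  simp [forallNodes, withEntries_eq, withMasks_eq, withValue_eq, allTrue_eq, nodeMask]

theorem exists_maskLe_of_hasLower {ms : List ℕ} {n : ℕ} (h : hasLower ms n = true) :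
    ∃ m ∈ ms, MaskLe m n := by
  induction ms with
  | nil => exact absurd h Bool.false_ne_true
  | cons m ms ih =>
    change (bif (Nat.land m n).beq m then true else hasLower ms n) = true at h
    cases hm : (Nat.land m n).beq m
    · rw [hm] at h
      obtain ⟨k, hk, h⟩ := ih h
      exact ⟨k, List.mem_cons_of_mem m hk, h⟩
    · exact ⟨m, List.mem_cons_self, maskLe_of_land_eq hm⟩

/-- Induction on the tree. Listed subtrees enter with their exact masks, all others with a lower
bound from `lower`; by monotonicity a lower mask below the glued bounds is also below the true mask.
Only a node of two listed trees can be listed again. -/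
theorem mem_or_exists_maskLe {small : List (BinTree × ℕ)} {lower : List ℕ}
    (hleaf : (leaf, treeMask leaf) ∈ small)
    (h₁ : forallNodes Prod.snd Prod.snd (fun a b n =>
      (small.any fun c => c.1.beq (node a.1 b.1) && c.2.beq n) || hasLower lower n)
        small small = true)
    (h₂ : forallNodes Prod.snd id (fun _ _ => hasLower lower) small lower = true)
    (h₃ : forallNodes id Prod.snd (fun _ _ => hasLower lower) lower small = true)
    (h₄ : forallNodes id id (fun _ _ => hasLower lower) lower lower = true) (t : BinTree) :
    (t, treeMask t) ∈ small ∨ ∃ m ∈ lower, MaskLe m (treeMask t) := by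
  simp only [forallNodes_iff, id_eq] at h₁ h₂ h₃ h₄
  generalize hM : nodeMask = M at h₁ h₂ h₃ h₄
  induction t with
  | leaf => exact Or.inl hleaf
  | node l r ihl ihr =>
    rw [treeMask_node, hM]
    have of_hasLower {m n : ℕ} (hm : MaskLe m (treeMask l)) (hn : MaskLe n (treeMask r))
        (h : hasLower lower (M m n) = true) :
        ∃ m ∈ lower, MaskLe m (M (treeMask l) (treeMask r)) := by
      obtain ⟨k, hk, h⟩ := exists_maskLe_of_hasLower h
      exact ⟨k, hk, h.trans (hM ▸ hm.nodeMask hn)⟩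
    obtain hl | ⟨m, hm, hml⟩ := ihl <;> obtain hr | ⟨n, hn, hnr⟩ := ihr
    · have h := h₁ _ hl _ hr
      dsimp only at h
      rw [Bool.or_eq_true] at h
      obtain h | h := h
      · obtain ⟨⟨t, n⟩, hc, h⟩ := List.any_eq_true.1 h
        rw [Bool.and_eq_true] at h
        obtain ⟨h1, h2⟩ := h
        have h1 : t = node l r := BinTree.eq_of_beq _ _ h1
        have h2 : n = M (treeMask l) (treeMask r) := Nat.eq_of_beq_eq_true h2
        rw [h1, h2] at hc
        exact Or.inl hc
      · exact Or.inr (of_hasLower (fun _ _ h => h) (fun _ _ h => h) h)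
    · exact Or.inr (of_hasLower (fun _ _ h => h) hnr (h₂ _ hl _ hn))
    · exact Or.inr (of_hasLower hml (fun _ _ h => h) (h₃ _ hm _ hr))
    · exact Or.inr (of_hasLower hml hnr (h₄ _ hm _ hn))

/-- This computation also confirms the masks in the list: a node counts as listed only if tree and
computed mask both agree. -/
theorem nodes_small_small : forallNodes Prod.snd Prod.snd (fun a b n =>
    (smallTrees.any fun c => c.1.beq (node a.1 b.1) && c.2.beq n) || hasLower lowerMasks n)
    smallTrees smallTrees = true := by
  decide +kernel

theorem nodes_small_lower : forallNodes Prod.snd id (fun _ _ => hasLower lowerMasks)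
    smallTrees lowerMasks = true := by
  decide +kernel

theorem nodes_lower_small : forallNodes id Prod.snd (fun _ _ => hasLower lowerMasks)
    lowerMasks smallTrees = true := by
  decide +kernel

theorem nodes_lower_lower : forallNodes id id (fun _ _ => hasLower lowerMasks)
    lowerMasks lowerMasks = true := by
  decide +kernel

theorem mem_smallTrees_or_exists_maskLe (t : BinTree) :
    (t, treeMask t) ∈ smallTrees ∨ ∃ m ∈ lowerMasks, MaskLe m (treeMask t) :=
  mem_or_exists_maskLe (List.mem_cons_self ..) nodes_small_small nodes_small_lower
    nodes_lower_small nodes_lower_lower t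

/-! ### The exceptional graphs are cubic Halin graphs -/

namespace RotationSystem

variable {V : Type*} {T : SimpleGraph V}

/-- The rotation system that is given by a function `next`: around `v`, the neighbour `w` is
followed by the neighbour `next v w`. -/
def ofNext (next : V → V → V) (h : ∀ v w, T.Adj v w → T.Adj v (next v w))
    (h₃ : ∀ v w, T.Adj v w → next v (next v (next v w)) = w)
    (hcycle : ∀ v w w', T.Adj v w → T.Adj v w' →
      w = w' ∨ next v w = w' ∨ next v (next v w) = w') : RotationSystem T where
  rot :=
    { toFun := fun d => ⟨(d.fst, next d.fst d.snd), h _ _ d.adj⟩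
      -- The third iterate of `next` is the identity at vertices of degree three as well as at
      -- leaves, so the inverse is the second iterate.
      invFun := fun d => ⟨(d.fst, next d.fst (next d.fst d.snd)), h _ _ (h _ _ d.adj)⟩
      left_inv := fun d => dart_ext rfl (h₃ _ _ d.adj)
      right_inv := fun d => dart_ext rfl (h₃ _ _ d.adj) }
  fst_rot _ := rfl
  sameCycle := by
    rintro ⟨⟨v, w⟩, hd⟩ ⟨⟨v', w'⟩, hd'⟩ (rfl : v = v')
    obtain hw | hw | hw := hcycle v w w' hd hd'
    · exact ⟨0, dart_ext rfl hw⟩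
    · exact ⟨1, dart_ext rfl hw⟩
    · exact ⟨2, dart_ext rfl hw⟩

end RotationSystem

open RotationSystem in
/-- A criterion for a graph to be Halin. The plane tree is given by the function `next`, and `succ`
maps each leaf to the next leaf. -/
theorem isHalin_of_next {V : Type*} [Finite V] {G T : SimpleGraph V} (hT : T.IsTree)
    (next : V → V → V) (h : ∀ v w, T.Adj v w → T.Adj v (next v w))
    (h₃ : ∀ v w, T.Adj v w → next v (next v (next v w)) = w)
    (hcycle : ∀ v w w', T.Adj v w → T.Adj v w' → w = w' ∨ next v w = w' ∨ next v (next v w) = w')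
    (L : Finset V) (hL : ∀ v, IsLeaf T v ↔ v ∈ L) (hcard : 3 ≤ L.card) (succ : V → V)
    (hsucc : ∀ v w, v ∈ L → T.Adj v w → succ v ∈ L ∧
      ∃ k, ((fun p : V × V => (p.2, next p.2 p.1))^[k] (v, w)).2 = succ v ∧
        ∀ i < k, ((fun p : V × V => (p.2, next p.2 p.1))^[i] (v, w)).2 ∉ L)
    (hG : ∀ v w, G.Adj v w ↔ T.Adj v w ∨ v ≠ w ∧ (v ∈ L ∧ succ v = w ∨ w ∈ L ∧ succ w = v)) :
    IsHalin G := by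
  let R : RotationSystem T := ofNext next h h₃ hcycle
  -- On pairs of vertices a face step maps `(u, v)` to `(v, next v u)`, which is computable without
  -- proofs of adjacency.
  have iter (k : ℕ) (d : T.Dart) : (R.faceStep^[k] d).snd =
      ((fun p : V × V => (p.2, next p.2 p.1))^[k] (d.fst, d.snd)).2 := by
    have := (Function.Semiconj.iterate_right (f := fun d : T.Dart => d.toProd)
      (ga := R.faceStep) (gb := fun p : V × V => (p.2, next p.2 p.1)) (fun _ => rfl) k) d
    exact congrArg Prod.snd this
  have nextLeaf (v w : V) : R.NextLeaf v w ↔ v ∈ L ∧ succ v = w := by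
    constructor
    · rintro ⟨hv, hw, d, k, rfl, rfl, hk⟩
      rw [hL] at hv hw
      refine ⟨hv, ?_⟩
      obtain ⟨hs, j, hj, hj'⟩ := hsucc _ _ hv d.adj
      rw [iter] at hw ⊢
      -- Both walks start with the same dart and stop at the first leaf, so they have the same
      -- length.
      simp only [iter, hL] at hk
      obtain hjk | rfl | hjk := lt_trichotomy j k
      · exact absurd (hj ▸ hs) (hk j hjk)
      · exact hj.symm
      · exact absurd hw (hj' k hjk)
    · rintro ⟨hv, rfl⟩
      obtain ⟨w, hw, -⟩ := (hL v).2 hv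
      obtain ⟨hs, k, hk, hk'⟩ := hsucc v w hv hw
      refine ⟨(hL v).2 hv, (hL _).2 hs, ⟨(v, w), hw⟩, k, rfl, (iter k _).trans hk, fun i hi => ?_⟩
      rw [hL, iter]
      exact hk' i hi
  refine ⟨T, R, hT, ?_, ?_⟩
  · have : {v | IsLeaf T v} = (L : Set V) := Set.ext hL
    rwa [this, Set.ncard_coe_finset]
  · ext v w
    rw [hG, SimpleGraph.sup_adj, leafCycle, SimpleGraph.fromRel_adj, nextLeaf, nextLeaf]

/-- A criterion for a finite graph to be a tree with a given root. -/
theorem isTree_of_parent {V : Type*} [Fintype V] {T : SimpleGraph V} [DecidableRel T.Adj] (r : V)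
    (parent : V → V) (h : ∀ v, v = r ∨ T.Adj v (parent v)) (k : ℕ) (hk : ∀ v, parent^[k] v = r)
    (hcard : ∑ v, T.degree v + 2 = 2 * Fintype.card V) : T.IsTree := by
  classical
  have reach (k : ℕ) (v : V) (hv : parent^[k] v = r) : T.Reachable v r := by
    induction k generalizing v with
    | zero => exact hv ▸ SimpleGraph.Reachable.rfl
    | succ k ih =>
      obtain rfl | hadj := h v
      · exact SimpleGraph.Reachable.rfl
      · exact hadj.reachable.trans (ih _ hv)
  rw [SimpleGraph.isTree_iff_connected_and_card]
  refine ⟨(SimpleGraph.connected_iff _).2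
    ⟨fun v w => (reach k v (hk v)).trans (reach k w (hk w)).symm, ⟨r⟩⟩, ?_⟩
  -- By the handshake lemma the condition on the degrees says that there is one edge less than
  -- vertices.
  rw [SimpleGraph.sum_degrees_eq_twice_card_edges] at hcard
  rw [Nat.card_eq_fintype_card, Nat.card_eq_fintype_card, ← SimpleGraph.edgeFinset_card]
  omega

section Neighbors

variable {n : ℕ}

/-- The graph in which the neighbours of the vertices are given by lists. -/
def ofNeighbors (nb : Fin n → List (Fin n)) : SimpleGraph (Fin n) :=
  SimpleGraph.fromRel fun v w => w ∈ nb v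

instance (nb : Fin n → List (Fin n)) : DecidableRel (ofNeighbors nb).Adj := fun v w =>
  decidable_of_iff (v ≠ w ∧ (w ∈ nb v ∨ v ∈ nb w))
    (SimpleGraph.fromRel_adj (fun v w => w ∈ nb v) v w).symm

/-- The element that follows `w` in a list, read as a cycle. -/
def nextIn (l : List (Fin n)) (w : Fin n) : Fin n :=
  l.getD ((l.idxOf w + 1) % l.length) w

/-- A criterion for a graph on the vertices `0, …, n - 1` to be Halin: the plane tree is given by
the lists of the neighbours of its vertices in their anticlockwise order, the first `k` vertices
are the leaves, in this order, and `parent` maps every vertex to the next vertex on the way to the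
root. -/
theorem isHalin_of_neighbors {G : SimpleGraph (Fin n)} [DecidableRel G.Adj] (k : ℕ) (hk : 3 ≤ k)
    (hkn : k ≤ n) (nb : Fin n → List (Fin n)) (succ parent : Fin n → Fin n) (r : Fin n)
    (hparent : ∀ v, v = r ∨ (ofNeighbors nb).Adj v (parent v)) (hr : ∀ v, parent^[n] v = r)
    (hcard : ∑ v, (ofNeighbors nb).degree v + 2 = 2 * n)
    (hleaf : ∀ v, (ofNeighbors nb).degree v = 1 ↔ v.val < k)
    (h : ∀ v w, (ofNeighbors nb).Adj v w → (ofNeighbors nb).Adj v (nextIn (nb v) w) ∧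
      nextIn (nb v) (nextIn (nb v) (nextIn (nb v) w)) = w ∧
      ∀ w', (ofNeighbors nb).Adj v w' →
        w = w' ∨ nextIn (nb v) w = w' ∨ nextIn (nb v) (nextIn (nb v) w) = w')
    (hsucc : ∀ v w, v.val < k → (ofNeighbors nb).Adj v w → (succ v).val < k ∧
      ∃ j < n, ((fun p : Fin n × Fin n => (p.2, nextIn (nb p.2) p.1))^[j] (v, w)).2 = succ v ∧
        ∀ i < j, ¬ ((fun p : Fin n × Fin n => (p.2, nextIn (nb p.2) p.1))^[i] (v, w)).2.val < k)
    (hG : ∀ v w, G.Adj v w ↔ (ofNeighbors nb).Adj v w ∨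
      v ≠ w ∧ (v.val < k ∧ succ v = w ∨ w.val < k ∧ succ w = v)) :
    IsHalin G := by
  have hmem (v : Fin n) : v ∈ (Finset.univ.filter fun v : Fin n => v.val < k) ↔ v.val < k := by
    simp
  refine isHalin_of_next (T := ofNeighbors nb)
    (isTree_of_parent r parent hparent n hr (by rwa [Fintype.card_fin])) (fun v => nextIn (nb v))
    (fun v w hw => (h v w hw).1) (fun v w hw => (h v w hw).2.1)
    (fun v w w' hw => (h v w hw).2.2 w') (Finset.univ.filter fun v : Fin n => v.val < k)
    (fun v => ?_) ?_ succ ?_ ?_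
  · rw [hmem, ← hleaf, SimpleGraph.degree_eq_one_iff_existsUnique_adj]
    rfl
  · have : (Finset.univ.filter fun v : Fin n => v.val < k).card = k := by
      rw [Fin.card_filter_val_lt, min_eq_right hkn]
    omega
  · intro v w hv hw
    simp only [hmem] at hv ⊢
    obtain ⟨h1, j, -, h2⟩ := hsucc v w hv hw
    exact ⟨h1, j, h2⟩
  · simpa only [hmem] using hG

end Neighbors

theorem IsHalin.connected {V : Type*} [Finite V] {H : SimpleGraph V} (h : IsHalin H) :
    H.Connected := by
  obtain ⟨T, R, hT, -, rfl⟩ := h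
  exact hT.connected.mono le_sup_left

namespace BinTree

/-- The number of vertices of a plane binary tree. -/
def size : BinTree → ℕ
  | leaf => 1
  | node l r => 1 + size l + size r

/-- The index of a vertex in preorder. -/
def index : (t : BinTree) → Pos t → ℕ
  | leaf, _ => 0
  | node _ _, none => 0
  | node l _, some (Sum.inl x) => 1 + index l x
  | node l r, some (Sum.inr x) => 1 + size l + index r x

/-- Labels for the vertices of the Halin graph of a plane binary tree. -/
def label {α : Type} (a : α) (L : List α) (t : BinTree) : Option (Pos t) → α
  | none => L.getD 0 a
  | some x => L.getD (1 + index t x) a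

end BinTree

theorem isHalin_K4 : IsHalin K4 := by
  -- The plane tree is a star with centre 3. The successor matters at leaves only, so its value 0 at
  -- the centre is arbitrary; likewise for inner vertices in the next three proofs.
  refine isHalin_of_neighbors 3 le_rfl (by decide) ![[3], [3], [3], [0, 1, 2]] ![1, 2, 0, 0]
    ![3, 3, 3, 3] 3 ?_ ?_ ?_ ?_ ?_ ?_ ?_ <;> decide +kernel

theorem isHalin_H4 : IsHalin H4 := by
  refine isHalin_of_neighbors 6 (by decide) (by decide)
    ![[6], [6], [7], [8], [9], [9], [0, 1, 7], [6, 2, 8], [7, 3, 9], [8, 4, 5]]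
    ![1, 2, 3, 4, 5, 0, 0, 0, 0, 0] ![6, 6, 7, 8, 9, 9, 6, 6, 7, 8] 6 ?_ ?_ ?_ ?_ ?_ ?_ ?_ <;>
    decide +kernel

theorem isHalin_H5 : IsHalin H5 := by
  refine isHalin_of_neighbors 7 (by decide) (by decide)
    ![[7], [7], [8], [9], [10], [11], [11], [0, 1, 8], [7, 2, 9], [8, 3, 10], [9, 4, 11],
      [10, 5, 6]]
    ![1, 2, 3, 4, 5, 6, 0, 0, 0, 0, 0, 0] ![7, 7, 8, 9, 10, 11, 11, 7, 7, 8, 9, 10] 7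
    ?_ ?_ ?_ ?_ ?_ ?_ ?_ <;> decide +kernel

theorem isHalin_H8 : IsHalin H8 := by
  refine isHalin_of_neighbors 10 (by decide) (by decide)
    ![[10], [10], [11], [12], [14], [14], [15], [16], [17], [17], [0, 1, 11], [10, 2, 12],
      [11, 3, 13], [12, 14, 15], [13, 4, 5], [13, 6, 16], [15, 7, 17], [16, 8, 9]]
    ![1, 2, 3, 4, 5, 6, 7, 8, 9, 0, 0, 0, 0, 0, 0, 0, 0, 0]
    ![10, 10, 11, 12, 14, 14, 15, 16, 17, 17, 11, 12, 13, 13, 13, 13, 15, 16] 13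
    ?_ ?_ ?_ ?_ ?_ ?_ ?_ <;> decide +kernel

theorem isRegularOfDegree_K4 : K4.IsRegularOfDegree 3 := by
  unfold SimpleGraph.IsRegularOfDegree
  decide +kernel

theorem isRegularOfDegree_H4 : H4.IsRegularOfDegree 3 := by
  unfold SimpleGraph.IsRegularOfDegree
  decide +kernel

theorem isRegularOfDegree_H5 : H5.IsRegularOfDegree 3 := by
  unfold SimpleGraph.IsRegularOfDegree
  decide +kernel

theorem isRegularOfDegree_H8 : H8.IsRegularOfDegree 3 := by
  unfold SimpleGraph.IsRegularOfDegree
  decide +kernel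

/-! ### The binary trees of the exceptional graphs -/

/-- The plane binary trees that belong to `K4`, each with the vertices of `K4` that correspond to
the vertices of the Halin graph of the tree in preorder. -/
def treesK4 : List (BinTree × List (Fin 4)) := [
  ((.node .leaf .leaf),
    [0, 1, 2, 3])]

/-- The plane binary trees that belong to `H4`, each with the vertices of `H4` that correspond to
the vertices of the Halin graph of the tree in preorder. -/
def treesH4 : List (BinTree × List (Fin 10)) := [
  ((.node .leaf (.node .leaf (.node .leaf (.node .leaf .leaf)))),
    [0, 1, 6, 2, 7, 3, 8, 4, 9, 5]),
  ((.node .leaf (.node (.node (.node .leaf .leaf) .leaf) .leaf)),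
    [1, 6, 0, 7, 8, 9, 5, 4, 3, 2]),
  ((.node (.node .leaf .leaf) (.node (.node .leaf .leaf) .leaf)),
    [2, 7, 6, 1, 0, 8, 9, 5, 4, 3]),
  ((.node (.node .leaf (.node .leaf .leaf)) (.node .leaf .leaf)),
    [2, 7, 8, 3, 9, 4, 5, 6, 0, 1]),
  ((.node (.node .leaf (.node .leaf (.node .leaf .leaf))) .leaf),
    [1, 6, 7, 2, 8, 3, 9, 4, 5, 0]),
  ((.node (.node (.node (.node .leaf .leaf) .leaf) .leaf) .leaf),
    [0, 1, 2, 3, 4, 5, 9, 8, 7, 6])]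

/-- The plane binary trees that belong to `H5`, each with the vertices of `H5` that correspond to
the vertices of the Halin graph of the tree in preorder. -/
def treesH5 : List (BinTree × List (Fin 12)) := [
  ((.node .leaf (.node .leaf (.node .leaf (.node .leaf (.node .leaf .leaf))))),
    [0, 1, 7, 2, 8, 3, 9, 4, 10, 5, 11, 6]),
  ((.node .leaf (.node (.node (.node (.node .leaf .leaf) .leaf) .leaf) .leaf)),
    [1, 7, 0, 8, 9, 10, 11, 6, 5, 4, 3, 2]),
  ((.node (.node .leaf .leaf) (.node (.node (.node .leaf .leaf) .leaf) .leaf)),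
    [2, 8, 7, 1, 0, 9, 10, 11, 6, 5, 4, 3]),
  ((.node (.node .leaf (.node .leaf .leaf)) (.node (.node .leaf .leaf) .leaf)),
    [3, 9, 8, 2, 7, 1, 0, 10, 11, 6, 5, 4]),
  ((.node (.node .leaf (.node .leaf (.node .leaf .leaf))) (.node .leaf .leaf)),
    [2, 8, 9, 3, 10, 4, 11, 5, 6, 7, 0, 1]),
  ((.node (.node .leaf (.node .leaf (.node .leaf (.node .leaf .leaf)))) .leaf),
    [1, 7, 8, 2, 9, 3, 10, 4, 11, 5, 6, 0]),
  ((.node (.node (.node (.node (.node .leaf .leaf) .leaf) .leaf) .leaf) .leaf),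
    [0, 1, 2, 3, 4, 5, 6, 11, 10, 9, 8, 7])]

/-- The plane binary trees that belong to `H8`, each with the vertices of `H8` that correspond to
the vertices of the Halin graph of the tree in preorder. -/
def treesH8 : List (BinTree × List (Fin 18)) := [
  ((.node .leaf (.node .leaf (.node .leaf (.node (.node .leaf .leaf) (.node .leaf (.node .leaf (.node .leaf .leaf))))))),
    [0, 10, 1, 11, 2, 12, 3, 13, 14, 4, 5, 15, 6, 16, 7, 17, 8, 9]),
  ((.node .leaf (.node (.node .leaf (.node .leaf (.node .leaf .leaf))) (.node (.node (.node .leaf .leaf) .leaf) .leaf))),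
    [4, 14, 5, 13, 15, 6, 16, 7, 17, 8, 9, 12, 11, 10, 0, 1, 2, 3]),
  ((.node .leaf (.node (.node (.node (.node (.node (.node .leaf .leaf) .leaf) .leaf) (.node .leaf .leaf)) .leaf) .leaf)),
    [1, 10, 0, 11, 12, 13, 15, 16, 17, 9, 8, 7, 6, 14, 5, 4, 3, 2]),
  ((.node (.node .leaf .leaf) (.node (.node (.node (.node (.node .leaf .leaf) .leaf) .leaf) (.node .leaf .leaf)) .leaf)),
    [2, 11, 10, 1, 0, 12, 13, 15, 16, 17, 9, 8, 7, 6, 14, 5, 4, 3]),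
  ((.node (.node .leaf (.node .leaf .leaf)) (.node (.node (.node (.node .leaf .leaf) .leaf) .leaf) (.node .leaf .leaf))),
    [3, 12, 11, 2, 10, 1, 0, 13, 15, 16, 17, 9, 8, 7, 6, 14, 5, 4]),
  ((.node (.node (.node .leaf .leaf) (.node .leaf (.node .leaf (.node .leaf .leaf)))) (.node (.node .leaf .leaf) .leaf)),
    [3, 12, 13, 14, 4, 5, 15, 6, 16, 7, 17, 8, 9, 11, 10, 0, 1, 2]),
  ((.node (.node .leaf (.node (.node .leaf .leaf) (.node .leaf (.node .leaf (.node .leaf .leaf))))) (.node .leaf .leaf)),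
    [2, 11, 12, 3, 13, 14, 4, 5, 15, 6, 16, 7, 17, 8, 9, 10, 0, 1]),
  ((.node (.node .leaf (.node .leaf (.node (.node .leaf .leaf) (.node .leaf (.node .leaf (.node .leaf .leaf)))))) .leaf),
    [1, 10, 11, 2, 12, 3, 13, 14, 4, 5, 15, 6, 16, 7, 17, 8, 9, 0]),
  ((.node (.node (.node .leaf (.node .leaf (.node .leaf .leaf))) (.node (.node (.node .leaf .leaf) .leaf) .leaf)) .leaf),
    [4, 14, 13, 12, 3, 11, 2, 10, 1, 0, 15, 16, 17, 9, 8, 7, 6, 5]),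
  ((.node (.node (.node (.node (.node (.node (.node .leaf .leaf) .leaf) .leaf) (.node .leaf .leaf)) .leaf) .leaf) .leaf),
    [0, 10, 11, 12, 13, 15, 16, 17, 9, 8, 7, 6, 14, 5, 4, 3, 2, 1])]

theorem nonempty_iso_of_forall_label {n : ℕ} [NeZero n] {G : SimpleGraph (Fin n)}
    [DecidableRel G.Adj] (hG : G.IsRegularOfDegree 3) (hH : IsHalin G) {t : BinTree}
    (L : List (Fin n)) (ht : t.beq leaf = false)
    (hinj : ∀ x y, label 0 L t x = label 0 L t y → x = y)
    (hom : ∀ x y, (halin t).Adj x y → G.Adj (label 0 L t x) (label 0 L t y)) :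
    Nonempty (halin t ≃g G) := by
  refine nonempty_iso_of_injective_hom (k := 3) (halin_isRegularOfDegree ?_) hG hH.connected
    (label 0 L t) (fun x y => hinj x y) hom
  rintro rfl
  exact Bool.noConfusion ht

theorem nonempty_iso_K4 : ∀ e ∈ treesK4, Nonempty (halin e.1 ≃g K4) := by
  have h : ∀ e ∈ treesK4, e.1.beq leaf = false ∧
      (∀ x y, label 0 e.2 e.1 x = label 0 e.2 e.1 y → x = y) ∧
      ∀ x y, (halin e.1).Adj x y → K4.Adj (label 0 e.2 e.1 x) (label 0 e.2 e.1 y) := by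
    decide +kernel
  exact fun e he => nonempty_iso_of_forall_label isRegularOfDegree_K4 isHalin_K4 e.2
    (h e he).1 (h e he).2.1 (h e he).2.2

theorem nonempty_iso_H4 : ∀ e ∈ treesH4, Nonempty (halin e.1 ≃g H4) := by
  have h : ∀ e ∈ treesH4, e.1.beq leaf = false ∧
      (∀ x y, label 0 e.2 e.1 x = label 0 e.2 e.1 y → x = y) ∧
      ∀ x y, (halin e.1).Adj x y → H4.Adj (label 0 e.2 e.1 x) (label 0 e.2 e.1 y) := by
    decide +kernel
  exact fun e he => nonempty_iso_of_forall_label isRegularOfDegree_H4 isHalin_H4 e.2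
    (h e he).1 (h e he).2.1 (h e he).2.2

theorem nonempty_iso_H5 : ∀ e ∈ treesH5, Nonempty (halin e.1 ≃g H5) := by
  have h : ∀ e ∈ treesH5, e.1.beq leaf = false ∧
      (∀ x y, label 0 e.2 e.1 x = label 0 e.2 e.1 y → x = y) ∧
      ∀ x y, (halin e.1).Adj x y → H5.Adj (label 0 e.2 e.1 x) (label 0 e.2 e.1 y) := by
    decide +kernel
  exact fun e he => nonempty_iso_of_forall_label isRegularOfDegree_H5 isHalin_H5 e.2
    (h e he).1 (h e he).2.1 (h e he).2.2

theorem nonempty_iso_H8 : ∀ e ∈ treesH8, Nonempty (halin e.1 ≃g H8) := by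
  have h : ∀ e ∈ treesH8, e.1.beq leaf = false ∧
      (∀ x y, label 0 e.2 e.1 x = label 0 e.2 e.1 y → x = y) ∧
      ∀ x y, (halin e.1).Adj x y → H8.Adj (label 0 e.2 e.1 x) (label 0 e.2 e.1 y) := by
    decide +kernel
  exact fun e he => nonempty_iso_of_forall_label isRegularOfDegree_H8 isHalin_H8 e.2
    (h e he).1 (h e he).2.1 (h e he).2.2

/-! ### Four colours, five colours, and the lower bounds -/

theorem closesMask_of_mem_lowerMasks : ∀ m ∈ lowerMasks, closesMask m = true := by
  decide +kernel

theorem closesMask_of_mem_smallTrees : ∀ e ∈ smallTrees, closesMask e.2 = true ∨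
    e.1.beq leaf = true ∨ (∃ f ∈ treesK4, e.1.beq f.1 = true) ∨
    (∃ f ∈ treesH4, e.1.beq f.1 = true) ∨ (∃ f ∈ treesH5, e.1.beq f.1 = true) ∨
    ∃ f ∈ treesH8, e.1.beq f.1 = true := by
  decide +kernel

theorem halin_colorable_or_nonempty_iso {t : BinTree} (ht : t ≠ leaf) :
    (totalGraph (halin t)).Colorable 4 ∨ Nonempty (halin t ≃g K4) ∨ Nonempty (halin t ≃g H4) ∨
      Nonempty (halin t ≃g H5) ∨ Nonempty (halin t ≃g H8) := by
  rw [halin_colorable_iff_closesMask ht]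
  have hbeq (u : BinTree) (h : t.beq u = true) : t = u := BinTree.eq_of_beq t u h
  obtain h | ⟨m, hm, hle⟩ := mem_smallTrees_or_exists_maskLe t
  · obtain h | h | ⟨f, hf, h⟩ | ⟨f, hf, h⟩ | ⟨f, hf, h⟩ | ⟨f, hf, h⟩ :=
      closesMask_of_mem_smallTrees _ h
    · exact Or.inl h
    · exact absurd (hbeq _ h) ht
    · exact Or.inr (Or.inl (hbeq _ h ▸ nonempty_iso_K4 f hf))
    · exact Or.inr (Or.inr (Or.inl (hbeq _ h ▸ nonempty_iso_H4 f hf)))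
    · exact Or.inr (Or.inr (Or.inr (Or.inl (hbeq _ h ▸ nonempty_iso_H5 f hf))))
    · exact Or.inr (Or.inr (Or.inr (Or.inr (hbeq _ h ▸ nonempty_iso_H8 f hf))))
  · exact Or.inl (hle.closesMask (closesMask_of_mem_lowerMasks m hm))

theorem totalGraph_colorable_of_iso {V W : Type*} {G : SimpleGraph V} {H : SimpleGraph W} {n : ℕ}
    (e : G ≃g H) (h : (totalGraph H).Colorable n) : (totalGraph G).Colorable n :=
  totalGraph_colorable_of_injective e e.injective (fun _ _ => e.map_adj_iff.2) h

/-- One tree for the graph is enough, since its mask decides the colourability exactly. -/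
theorem not_colorable_of_closesMask {V : Type*} {G : SimpleGraph V} {t : BinTree}
    (e : Nonempty (halin t ≃g G)) (ht : t ≠ leaf) (h : closesMask (treeMask t) = false) :
    ¬ (totalGraph G).Colorable 4 := by
  rintro hc
  obtain ⟨e⟩ := e
  have := (halin_colorable_iff_closesMask ht).1 (totalGraph_colorable_of_iso e hc)
  simp [h] at this

theorem not_colorable_four_K4 : ¬ (totalGraph K4).Colorable 4 :=
  not_colorable_of_closesMask (nonempty_iso_K4 _ (List.head_mem (by decide : treesK4 ≠ [])))
    BinTree.noConfusion (by decide +kernel)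

theorem not_colorable_four_H4 : ¬ (totalGraph H4).Colorable 4 :=
  not_colorable_of_closesMask (nonempty_iso_H4 _ (List.head_mem (by decide : treesH4 ≠ [])))
    BinTree.noConfusion (by decide +kernel)

theorem not_colorable_four_H5 : ¬ (totalGraph H5).Colorable 4 :=
  not_colorable_of_closesMask (nonempty_iso_H5 _ (List.head_mem (by decide : treesH5 ≠ [])))
    BinTree.noConfusion (by decide +kernel)

theorem not_colorable_four_H8 : ¬ (totalGraph H8).Colorable 4 :=
  not_colorable_of_closesMask (nonempty_iso_H8 _ (List.head_mem (by decide : treesH8 ≠ [])))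
    BinTree.noConfusion (by decide +kernel)

/-- The edges are coloured by sums `a x + a y` modulo 5. Edges at a common vertex then differ as
soon as `a` is injective on its neighbours, so a colouring is given by two short vectors. -/
theorem totalGraph_colorable_five {n : ℕ} {G : SimpleGraph (Fin n)} (a v : Fin n → Fin 5)
    (hadj : ∀ x y, G.Adj x y → v x ≠ v y ∧ v x ≠ a x + a y)
    (hedge : ∀ x y z, G.Adj x y → G.Adj x z → y ≠ z → a y ≠ a z) :
    (totalGraph G).Colorable 5 := by
  refine totalGraph_colorable_of_forall (C := Fin 5) v (fun x y => a x + a y)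
    (fun x y => add_comm _ _) (fun x y h => (hadj x y h).1) (fun x y h => (hadj x y h).2)
    (fun x y z hy hz h => ?_)
  exact fun he => hedge x y z hy hz h (add_left_cancel he)

theorem colorable_five_K4 : (totalGraph K4).Colorable 5 := by
  refine totalGraph_colorable_five ![2, 0, 1, 3]
    ![1, 4, 0, 2] ?_ ?_ <;> decide +kernel

theorem colorable_five_H4 : (totalGraph H4).Colorable 5 := by
  refine totalGraph_colorable_five ![2, 0, 1, 2, 4, 1, 4, 4, 0, 3]
    ![0, 3, 2, 4, 3, 2, 2, 1, 0, 1] ?_ ?_ <;> decide +kernel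

theorem colorable_five_H5 : (totalGraph H5).Colorable 5 := by
  refine totalGraph_colorable_five ![2, 0, 1, 2, 4, 1, 3, 4, 1, 2, 4, 0]
    ![3, 0, 4, 0, 2, 3, 1, 2, 1, 2, 0, 2] ?_ ?_ <;> decide +kernel

theorem colorable_five_H8 : (totalGraph H8).Colorable 5 := by
  refine totalGraph_colorable_five ![2, 0, 1, 2, 4, 1, 1, 4, 0, 2, 4, 1, 0, 3, 3, 2, 4, 1]
    ![0, 3, 0, 4, 3, 1, 4, 1, 0, 1, 2, 3, 0, 4, 0, 2, 4, 2] ?_ ?_ <;> decide +kernel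

/-- A vertex and its three edges form a clique of size four in the total graph. -/
theorem not_colorable_three {V : Type*} [Fintype V] {H : SimpleGraph V} [DecidableRel H.Adj]
    (hreg : H.IsRegularOfDegree 3) (v : V) : ¬ (totalGraph H).Colorable 3 := by
  classical
  rintro ⟨c⟩
  let f : Option (H.neighborSet v) → V ⊕ H.edgeSet
    | none => Sum.inl v
    | some w => Sum.inr ⟨s(v, w.1), w.2⟩
  have hf : Function.Injective (c ∘ f) := by
    intro x y hxy
    by_contra hne
    refine c.valid (v := f x) (w := f y) ?_ hxy
    match x, y with
    | none, none => exact absurd rfl hne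
    | none, some w => exact Sym2.mem_mk_left v w.1
    | some w, none => exact Sym2.mem_mk_left v w.1
    | some w, some w' =>
      refine ⟨fun h => hne ?_, v, Sym2.mem_mk_left v w.1, Sym2.mem_mk_left v w'.1⟩
      exact congrArg some (Subtype.ext (Sym2.congr_right.1 (Subtype.ext_iff.1 h)))
  have := Fintype.card_le_of_injective _ hf
  rw [Fintype.card_option, SimpleGraph.card_neighborSet_eq_degree, hreg v, Fintype.card_fin] at this
  omega

theorem totalChromaticNumber_eq_four {V : Type*} [Fintype V] {H : SimpleGraph V}
    [DecidableRel H.Adj] (hreg : H.IsRegularOfDegree 3) (hH : IsHalin H)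
    (h : (totalGraph H).Colorable 4) : totalChromaticNumber H = 4 :=
  SimpleGraph.chromaticNumber_eq_iff_colorable_not_colorable.2
    ⟨h, not_colorable_three hreg hH.connected.nonempty.some⟩

theorem totalChromaticNumber_eq_five {V : Type*} {H : SimpleGraph V}
    (h : (totalGraph H).Colorable 5) (h' : ¬ (totalGraph H).Colorable 4) :
    totalChromaticNumber H = 5 :=
  SimpleGraph.chromaticNumber_eq_iff_colorable_not_colorable.2 ⟨h, h'⟩

end HalinGraph

theorem theorem1 :
    (∀ (V : Type*) [Fintype V] (H : SimpleGraph V) [DecidableRel H.Adj],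
      H.IsRegularOfDegree 3 → HalinGraph.IsHalin H →
      IsEmpty (H ≃g HalinGraph.K4) → IsEmpty (H ≃g HalinGraph.H4) →
      IsEmpty (H ≃g HalinGraph.H5) → IsEmpty (H ≃g HalinGraph.H8) →
      HalinGraph.totalChromaticNumber H = 4) ∧
    (HalinGraph.K4.IsRegularOfDegree 3 ∧ HalinGraph.IsHalin HalinGraph.K4 ∧
      HalinGraph.totalChromaticNumber HalinGraph.K4 = 5) ∧
    (HalinGraph.H4.IsRegularOfDegree 3 ∧ HalinGraph.IsHalin HalinGraph.H4 ∧
      HalinGraph.totalChromaticNumber HalinGraph.H4 = 5) ∧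
    (HalinGraph.H5.IsRegularOfDegree 3 ∧ HalinGraph.IsHalin HalinGraph.H5 ∧
      HalinGraph.totalChromaticNumber HalinGraph.H5 = 5) ∧
    (HalinGraph.H8.IsRegularOfDegree 3 ∧ HalinGraph.IsHalin HalinGraph.H8 ∧
      HalinGraph.totalChromaticNumber HalinGraph.H8 = 5) := by
  open HalinGraph in
  refine ⟨?_, ⟨isRegularOfDegree_K4, isHalin_K4, ?_⟩, ⟨isRegularOfDegree_H4, isHalin_H4, ?_⟩,
    ⟨isRegularOfDegree_H5, isHalin_H5, ?_⟩, ⟨isRegularOfDegree_H8, isHalin_H8, ?_⟩⟩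
  · intro V _ H _ hreg hH hK4 hH4 hH5 hH8
    obtain ⟨t, ht, ⟨e⟩⟩ := exists_iso_halin hreg hH
    obtain h | ⟨⟨f⟩⟩ | ⟨⟨f⟩⟩ | ⟨⟨f⟩⟩ | ⟨⟨f⟩⟩ := halin_colorable_or_nonempty_iso ht
    · exact totalChromaticNumber_eq_four hreg hH (totalGraph_colorable_of_iso e.symm h)
    · exact (hK4.false (e.symm.trans f)).elim
    · exact (hH4.false (e.symm.trans f)).elim
    · exact (hH5.false (e.symm.trans f)).elim
    · exact (hH8.false (e.symm.trans f)).elim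
  · exact totalChromaticNumber_eq_five colorable_five_K4 not_colorable_four_K4
  · exact totalChromaticNumber_eq_five colorable_five_H4 not_colorable_four_H4
  · exact totalChromaticNumber_eq_five colorable_five_H5 not_colorable_four_H5
  · exact totalChromaticNumber_eq_five colorable_five_H8 not_colorable_four_H8
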